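/- Let $N\ge 1$ be an integer and $Z>0$. For $a>0$ let $\Omega_a=\mathbb R^2\times(-a/2,a/2)$, identify $L^2(\Omega_a)^{\otimes N}=L^2(\Omega_a^N)$, and write points of $\Omega_a^N$ as $(r_1,\dots,r_N)$. Let $-\Delta$ be the Dirichlet Laplacian on $L^2(\Omega_a^N)$, with $\mathrm{Dom}(-\Delta)=\{\psi\in H_0^1(\Omega_a^N):\Delta\psi\in L^2(\Omega_a^N)\}$ ($\Delta$ in the sense of distributions), let $$\mathcal V=-\sum_{i=1}^N\frac{Z}{|r_i|}+\sum_{1\le i<j\le N}\frac1{|r_i-r_j|},\qquad H^a_{N,Z}=-\Delta+\mathcal V\ \text{ in } L^2(\Omega_a^N),$$ and for $a\in\mathbb C\setminus\{0\}$ let $\tilde H^a_{N,Z}=a^{-2}(-\Delta+a\mathcal V)$ in $L^2(\Omega_1^N)$, where $\mathcal V$ acts by multiplication, and $H^a_{N,Z}$ and $\tilde H^a_{N,Z}$ are a priori defined on the functions in $\mathrm{Dom}(-\Delta)$ with $\mathcal V\psi\in L^2$. Then: 1. For every $a>0$, $\mathrm{Dom}(H^a_{N,Z})=\mathrm{Dom}(-\Delta)$,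 and $(U_a\psi)(x)=a^{3N/2}\psi(ax)$ defines a unitary map $U_a:L^2(\Omega_a^N)\to L^2(\Omega_1^N)$ with $U_aH^a_{N,Z}U_a^{-1}=\tilde H^a_{N,Z}$ (equality of operators, including domains). 2. $a\mapsto\tilde H^a_{N,Z}$ is an analytic family of type (A) on $\mathbb C\setminus\{0\}$ with the fixed domain $\mathscr D=\mathrm{Dom}(-\Delta)\subset L^2(\Omega_1^N)$: every $\tilde H^a_{N,Z}$ is densely defined and closed with non-empty resolvent set, has domain $\mathscr D$, and $a\mapsto\tilde H^a_{N,Z}\psi$ is analytic on $\mathbb C\setminus\{0\}$ for every $\psi\in\mathscr D$. 3. $a\mapsto\tilde H^a_{N,Z}$ is an analytic family in the sense of Kato on $\mathbb C\setminus\{0\}$: every $\tilde H^a_{N,Z}$ is densely defined and closed with non-empty resolvent set, and for every $a_0\ne0$ there is $z_0\in\rho(\tilde H^{a_0}_{N,Z})$ such that $z_0\in\rho(\tilde H^{a}_{N,Z})$ for all $a$ near $a_0$ and $a\mapsto(\tilde H^a_{N,Z}-z_0)^{-1}$ is an analytic operator-valued function near $a_0$. 4. Let $a_0>0$ and let $E_0$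 be an isolated point of the spectrum of $H^{a_0}_{N,Z}$ that is an eigenvalue with one-dimensional eigenspace. Then there are $\delta,\varepsilon>0$ and analytic functions $E$ and $\Psi$ on the disc $B=\{a\in\mathbb C:|a-a_0|<\delta\}\subset\mathbb C\setminus\{0\}$, with values in $\mathbb C$ and $L^2(\Omega_1^N)$, such that $E(a_0)=E_0$ and, for every $a\in B$, $E(a)$ is the only point of $\sigma(\tilde H^a_{N,Z})$ in $\{|z-E_0|<\varepsilon\}$, it is an isolated eigenvalue of $\tilde H^a_{N,Z}$ of algebraic multiplicity one (its Riesz spectral projection has rank one), and $\Psi(a)\ne0$ satisfies $\tilde H^a_{N,Z}\Psi(a)=E(a)\Psi(a)$. Moreover, for every real $a\in B$ (then $a>0$), $E(a)$ is real and is the only point of $\sigma(H^a_{N,Z})$ in $\{|z-E_0|<\varepsilon\}$, it is an isolated eigenvalue of $H^a_{N,Z}$ with one-dimensional eigenspace, and $\|\Psi(a)\|=1$. -/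

import Mathlib

open MeasureTheory Topology

namespace AtomLayer

noncomputable section

/-! ### Unbounded operators: spectrum, resolvent, analytic families -/

section Operators

variable {H : Type*} [NormedAddCommGroup H] [NormedSpace ℂ H]

/-- `R` is the bounded everywhere defined inverse of `T - z : Dom T → H`. -/
def IsResolventAt (T : H →ₗ.[ℂ] H) (z : ℂ) (R : H →L[ℂ] H) : Prop :=
  (∀ y : H, ∃ h : R y ∈ T.domain, T ⟨R y, h⟩ - z • R y = y) ∧
    ∀ x : T.domain, R (T x - z • (x : H)) = x

/-- The resolvent set of `T`. -/
def opResolventSet (T : H →ₗ.[ℂ] H) : Set ℂ := {z | ∃ R : H →L[ℂ] H, IsResolventAt T z R}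

/-- The spectrum of `T`. -/
def spec (T : H →ₗ.[ℂ] H) : Set ℂ := (opResolventSet T)ᶜ

theorem IsResolventAt.unique {T : H →ₗ.[ℂ] H} {z : ℂ} {R R' : H →L[ℂ] H}
    (h : IsResolventAt T z R) (h' : IsResolventAt T z R') : R = R' := by
  ext y
  obtain ⟨hy, e⟩ := h'.1 y
  have := h.2 ⟨R' y, hy⟩
  rwa [e] at this

open Classical in
/-- The resolvent `(T - z)⁻¹` for `z` in the resolvent set (and `0` elsewhere). -/
def opResolvent (T : H →ₗ.[ℂ] H) (z : ℂ) : H →L[ℂ] H :=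
  if h : ∃ R : H →L[ℂ] H, IsResolventAt T z R then h.choose else 0

/-- A densely defined closed operator with non-empty resolvent set. -/
def IsClosedOpWithResolvent (T : H →ₗ.[ℂ] H) : Prop :=
  Dense (T.domain : Set H) ∧ T.IsClosed ∧ (opResolventSet T).Nonempty

/-- `β ↦ T β` is an analytic family of type (A) on the complex domain `O` with the common operator
domain `D`: each `T β` is closed with non-empty resolvent set, `Dom (T β) = D`, and `β ↦ T β ψ` is
analytic on `O` for every `ψ ∈ D`. -/
def IsAnalyticFamilyTypeA (O : Set ℂ) (D : Submodule ℂ H) (T : ℂ → H →ₗ.[ℂ] H) : Prop :=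
  IsOpen O ∧ IsConnected O ∧
    (∀ β ∈ O, IsClosedOpWithResolvent (T β)) ∧
    (∀ β ∈ O, (T β).domain = D) ∧
    ∀ ψ ∈ D, ∃ f : ℂ → H, AnalyticOnNhd ℂ f O ∧ ∀ β ∈ O, (ψ, f β) ∈ (T β).graph

/-- `β ↦ T β` is an analytic family in the sense of Kato on the complex domain `O`: each `T β` is
closed with non-empty resolvent set, and for every `β₀ ∈ O` there is `z₀ ∈ ρ(T β₀)` such that
`z₀ ∈ ρ(T β)` for `β` near `β₀` and `β ↦ (T β - z₀)⁻¹` is analytic near `β₀`. -/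
def IsAnalyticFamilyKato (O : Set ℂ) (T : ℂ → H →ₗ.[ℂ] H) : Prop :=
  IsOpen O ∧ IsConnected O ∧
    (∀ β ∈ O, IsClosedOpWithResolvent (T β)) ∧
    ∀ β₀ ∈ O, ∃ z₀ ∈ opResolventSet (T β₀),
      (∀ᶠ β in 𝓝 β₀, z₀ ∈ opResolventSet (T β)) ∧
      AnalyticAt ℂ (fun β => opResolvent (T β) z₀) β₀

/-- The geometric eigenspace `ker (T - l)`. -/
def eigenspace (T : H →ₗ.[ℂ] H) (l : ℂ) : Submodule ℂ H where
  carrier := {ψ | (ψ, l • ψ) ∈ T.graph}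
  zero_mem' := by
    change ((0 : H), l • (0 : H)) ∈ T.graph
    rw [smul_zero]
    exact T.graph.zero_mem
  add_mem' := fun {x y} hx hy => by
    change (x + y, l • (x + y)) ∈ T.graph
    rw [smul_add]
    exact T.graph.add_mem hx hy
  smul_mem' := fun c x hx => by
    change (c • x, l • c • x) ∈ T.graph
    rw [smul_comm]
    exact T.graph.smul_mem c hx

/-- `l` is an isolated point of the spectrum of `T`, and an eigenvalue with a one-dimensional
eigenspace. This is the notion of a non-degenerate isolated eigenvalue for a self-adjoint `T`. -/
def IsSimpleIsolatedEigenvalue (T : H →ₗ.[ℂ] H) (l : ℂ) : Prop :=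
  (∃ r > 0, spec T ∩ Metric.ball l r = {l}) ∧ Module.finrank ℂ (eigenspace T l) = 1

/-- `-(2πi)⁻¹ ∮_{|z - l| = r} (T - z)⁻¹ dz`. -/
def rieszProjection (T : H →ₗ.[ℂ] H) (l : ℂ) (r : ℝ) : H →L[ℂ] H :=
  (-(2 * (Real.pi : ℂ) * Complex.I)⁻¹) • ∮ z in C(l, r), opResolvent T z

/-- Non-degenerate discrete eigenvalue of a closed, not necessarily self-adjoint operator: `l` is
an isolated point of the spectrum and its spectral projection is one-dimensional, that is, `l` has
algebraic multiplicity one. -/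
def IsNondegenerateDiscreteEigenvalue (T : H →ₗ.[ℂ] H) (l : ℂ) : Prop :=
  ∃ r > 0, spec T ∩ Metric.closedBall l r = {l} ∧
    Module.finrank ℂ (LinearMap.range (rieszProjection T l r : H →ₗ[ℂ] H)) = 1

end Operators

/-! ### The configuration space of the layer -/

/-- Positions `(r_1, …, r_N)` of `N` particles in `ℝ³`. -/
abbrev Config (N : ℕ) : Type := Fin N → EuclideanSpace ℝ (Fin 3)

/-- The layer `Ω_a = ℝ² × (-a/2, a/2)`. -/
def layer (a : ℝ) : Set (EuclideanSpace ℝ (Fin 3)) := {r | |r 2| < a / 2}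

/-- `Ω_a × ⋯ × Ω_a` (`N` factors). -/
def layerPow (N : ℕ) (a : ℝ) : Set (Config N) := {x | ∀ i, x i ∈ layer a}

theorem isOpen_layerPow (N : ℕ) (a : ℝ) : IsOpen (layerPow N a) := by
  have e : layerPow N a = ⋂ i : Fin N, {x : Config N | |x i 2| < a / 2} := by
    ext x
    simp [layerPow, layer]
  rw [e]
  refine isOpen_iInter_of_finite fun i => ?_
  have hc : Continuous fun x : Config N => |x i 2| := by fun_prop
  exact isOpen_lt hc continuous_const

/-- Lebesgue measure on `Ω_a^N`. -/
abbrev layerMeasure (N : ℕ) (a : ℝ) : Measure (Config N) := volume.restrict (layerPow N a)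

/-- `L²(Ω_a)^{⊗N} = L²(Ω_a^N)`. -/
abbrev L2 (N : ℕ) (a : ℝ) : Type := Lp ℂ 2 (layerMeasure N a)

/-! ### The Dirichlet Laplacian -/

/-- The partial derivative in the `k`-th Cartesian coordinate of the `i`-th particle. -/
def pd {N : ℕ} (i : Fin N) (k : Fin 3) (φ : Config N → ℂ) : Config N → ℂ :=
  fun x => fderiv ℝ φ x (Pi.single i (EuclideanSpace.single k 1))

/-- `Δ φ = ∑_i Δ_{r_i} φ` for smooth functions `φ`. -/
def lap {N : ℕ} (φ : Config N → ℂ) : Config N → ℂ :=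
  fun x => ∑ i : Fin N, ∑ k : Fin 3, pd i k (pd i k φ) x

/-- `φ ∈ C_c^∞(U)`. -/
def IsTest {N : ℕ} (U : Set (Config N)) (φ : Config N → ℂ) : Prop :=
  ContDiff ℝ (⊤ : ℕ∞) φ ∧ HasCompactSupport φ ∧ tsupport φ ⊆ U

section TestFunctions

variable {N : ℕ} {U : Set (Config N)} {φ χ : Config N → ℂ}

theorem IsTest.zero : IsTest U (0 : Config N → ℂ) :=
  ⟨contDiff_const, HasCompactSupport.zero, by
    rw [tsupport_eq_empty_iff.2 rfl]; exact Set.empty_subset U⟩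

theorem IsTest.add (h : IsTest U φ) (h' : IsTest U χ) : IsTest U (φ + χ) :=
  ⟨h.1.add h'.1, h.2.1.add h'.2.1,
    (tsupport_add φ χ).trans (Set.union_subset h.2.2 h'.2.2)⟩

theorem IsTest.smul (c : ℂ) (h : IsTest U φ) : IsTest U (c • φ) :=
  ⟨contDiff_const.smul h.1, h.2.1.smul_left (f := fun _ => c),
    (tsupport_smul_subset_right (fun _ => c) φ).trans h.2.2⟩

theorem IsTest.pd (h : IsTest U φ) (i : Fin N) (k : Fin 3) : IsTest U (pd i k φ) := by
  refine ⟨?_, h.2.1.fderiv_apply ℝ _, (tsupport_fderiv_apply_subset ℝ _).trans h.2.2⟩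
  exact (h.1.fderiv_right (m := (⊤ : ℕ∞)) (by simp)).clm_apply contDiff_const

theorem IsTest.lap (h : IsTest U φ) : IsTest U (lap φ) := by
  have key : ∀ s : Finset (Fin N × Fin 3),
      IsTest U (∑ p ∈ s, AtomLayer.pd p.1 p.2 (AtomLayer.pd p.1 p.2 φ)) := by
    intro s
    classical
    induction s using Finset.induction_on with
    | empty => simpa using IsTest.zero
    | insert p s hp ih =>
      rw [Finset.sum_insert hp]
      exact ((h.pd _ _).pd _ _).add ih
  have e : AtomLayer.lap φ
      = ∑ p : Fin N × Fin 3, AtomLayer.pd p.1 p.2 (AtomLayer.pd p.1 p.2 φ) := by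
    ext x
    simp [AtomLayer.lap, Fintype.sum_prod_type]
  rw [e]
  exact key _

theorem IsTest.differentiable (h : IsTest U φ) : Differentiable ℝ φ :=
  h.1.differentiable (by simp)

theorem IsTest.memLp (h : IsTest U φ) (μ : Measure (Config N)) [IsFiniteMeasureOnCompacts μ] :
    MemLp φ 2 μ :=
  h.1.continuous.memLp_of_hasCompactSupport h.2.1

theorem integrable_mul_test {a : ℝ} (ψ : L2 N a) (h : IsTest U φ) :
    Integrable (fun x => ψ x * φ x) (layerMeasure N a) :=
  (Lp.memLp ψ).integrable_mul (h.memLp _)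

end TestFunctions

/-- The pairs `(φ, ∇φ)`, `φ ∈ C_c^∞(Ω_a^N)`, in `L²(Ω_a^N) × L²(Ω_a^N)^{3N}`. -/
def testGraph (N : ℕ) (a : ℝ) : Submodule ℂ (L2 N a × (Fin N → Fin 3 → L2 N a)) where
  carrier := {p | ∃ φ, IsTest (layerPow N a) φ ∧ p.1 =ᵐ[layerMeasure N a] φ ∧
    ∀ i k, p.2 i k =ᵐ[layerMeasure N a] pd i k φ}
  zero_mem' := ⟨0, IsTest.zero, Lp.coeFn_zero _ _ _, fun i k => by
    filter_upwards [Lp.coeFn_zero ℂ 2 (layerMeasure N a)] with x hx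
    simp only [Prod.snd_zero, Pi.zero_apply, pd, fderiv_zero,
      zero_apply] at hx ⊢
    exact hx⟩
  add_mem' := by
    rintro p q ⟨φ, hφ, h1, h2⟩ ⟨χ, hχ, h3, h4⟩
    refine ⟨φ + χ, hφ.add hχ, (Lp.coeFn_add _ _).trans (h1.add h3), fun i k => ?_⟩
    refine (Lp.coeFn_add _ _).trans (((h2 i k).add (h4 i k)).trans (ae_of_all _ fun x => ?_))
    simp [pd, fderiv_add (hφ.differentiable x) (hχ.differentiable x)]
  smul_mem' := by
    rintro c p ⟨φ, hφ, h1, h2⟩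
    refine ⟨c • φ, hφ.smul c, (Lp.coeFn_smul _ _).trans (h1.const_smul c), fun i k => ?_⟩
    refine (Lp.coeFn_smul _ _).trans (((h2 i k).const_smul c).trans (ae_of_all _ fun x => ?_))
    simp [pd, fderiv_const_smul (hφ.differentiable x) c]

/-- The Sobolev space `H_0^1(Ω_a^N)`: the closure of `C_c^∞(Ω_a^N)` in the `H^1` norm, that is,
the limits in `L²` of test functions whose gradients converge in `L²` as well. -/
def H10 (N : ℕ) (a : ℝ) : Submodule ℂ (L2 N a) :=
  (testGraph N a).topologicalClosure.map (LinearMap.fst ℂ _ _)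

/-- The pairs `(ψ, f)` with `ψ ∈ H_0^1(Ω_a^N)`, `f ∈ L²(Ω_a^N)` and `-Δ ψ = f` in the sense of
distributions on `Ω_a^N`. -/
def dirichletGraph (N : ℕ) (a : ℝ) : Submodule ℂ (L2 N a × L2 N a) where
  carrier := {p | p.1 ∈ H10 N a ∧ ∀ φ, IsTest (layerPow N a) φ →
    ∫ x, p.2 x * φ x ∂(layerMeasure N a) = -∫ x, p.1 x * lap φ x ∂(layerMeasure N a)}
  zero_mem' := by
    refine ⟨(H10 N a).zero_mem, fun φ _ => ?_⟩
    have h0 : ∀ g : Config N → ℂ,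
        ∫ x, (0 : L2 N a) x * g x ∂(layerMeasure N a) = 0 := fun g => by
      refine integral_eq_zero_of_ae ?_
      filter_upwards [Lp.coeFn_zero ℂ 2 (layerMeasure N a)] with x hx
      rw [hx, Pi.zero_apply, zero_mul]
    simp only [Prod.fst_zero, Prod.snd_zero, h0, neg_zero]
  add_mem' := by
    rintro p q ⟨hp, hp'⟩ ⟨hq, hq'⟩
    refine ⟨(H10 N a).add_mem hp hq, fun φ hφ => ?_⟩
    have hadd : ∀ (u v : L2 N a) (g : Config N → ℂ), IsTest (layerPow N a) g →
        ∫ x, (u + v) x * g x ∂(layerMeasure N a)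
          = ∫ x, u x * g x ∂(layerMeasure N a) + ∫ x, v x * g x ∂(layerMeasure N a) := by
      intro u v g hg
      rw [← integral_add (integrable_mul_test u hg) (integrable_mul_test v hg)]
      refine integral_congr_ae ?_
      filter_upwards [Lp.coeFn_add u v] with x hx
      rw [hx, Pi.add_apply, add_mul]
    simp only [Prod.fst_add, Prod.snd_add]
    rw [hadd _ _ _ hφ, hadd _ _ _ hφ.lap, hp' φ hφ, hq' φ hφ]
    ring
  smul_mem' := by
    rintro c p ⟨hp, hp'⟩
    refine ⟨(H10 N a).smul_mem c hp, fun φ hφ => ?_⟩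
    have hsmul : ∀ (u : L2 N a) (g : Config N → ℂ),
        ∫ x, (c • u) x * g x ∂(layerMeasure N a) = c * ∫ x, u x * g x ∂(layerMeasure N a) := by
      intro u g
      rw [← integral_const_mul]
      refine integral_congr_ae ?_
      filter_upwards [Lp.coeFn_smul c u] with x hx
      simp [hx, mul_assoc]
    simp only [Prod.smul_fst, Prod.smul_snd, hsmul, hp' φ hφ]
    ring

/-- `dirichletGraph` is the graph of an operator. -/
theorem dirichletGraph_functional (N : ℕ) (a : ℝ) :
    ∀ p ∈ dirichletGraph N a, p.1 = 0 → p.2 = 0 := by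
  rintro ⟨ψ, f⟩ ⟨-, h⟩ (rfl : ψ = 0)
  simp only at h ⊢
  have h0 : ∀ φ, IsTest (layerPow N a) φ → ∫ x, f x * φ x ∂(layerMeasure N a) = 0 := by
    intro φ hφ
    rw [h φ hφ, neg_eq_zero]
    refine integral_eq_zero_of_ae ?_
    filter_upwards [Lp.coeFn_zero ℂ 2 (layerMeasure N a)] with x hx
    rw [hx, Pi.zero_apply, zero_mul]
  have hloc : LocallyIntegrableOn f (layerPow N a) volume :=
    locallyIntegrableOn_of_locallyIntegrable_restrict
      ((Lp.memLp f).locallyIntegrable (by norm_num))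
  have hae := (isOpen_layerPow N a).ae_eq_zero_of_integral_contDiff_smul_eq_zero
    (μ := volume) hloc (fun g hg hgc hgs => by
      have hT : IsTest (layerPow N a) (fun x => (g x : ℂ)) := by
        refine ⟨Complex.ofRealCLM.contDiff.comp hg, hgc.comp_left (g := Complex.ofReal) rfl, ?_⟩
        exact (tsupport_comp_subset (g := Complex.ofReal) rfl g).trans hgs
      have := h0 _ hT
      rw [← setIntegral_eq_integral_of_forall_compl_eq_zero (s := layerPow N a)]
      · simpa [mul_comm] using this
      · intro x hx
        rw [image_eq_zero_of_notMem_tsupport (fun hx' => hx (hgs hx')), zero_smul])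
  refine Lp.ext ?_
  have : ∀ᵐ x ∂(layerMeasure N a), f x = 0 :=
    (ae_restrict_iff' (isOpen_layerPow N a).measurableSet).2 hae
  filter_upwards [this, Lp.coeFn_zero ℂ 2 (layerMeasure N a)] with x hx hx'
  rw [hx, hx', Pi.zero_apply]

/-- The (non-negative) Dirichlet Laplacian `-Δ` on `L²(Ω_a^N)`, with the domain
`{ψ ∈ H_0^1(Ω_a^N) : Δψ ∈ L²(Ω_a^N)}`. -/
def dirichletLaplacian (N : ℕ) (a : ℝ) : L2 N a →ₗ.[ℂ] L2 N a :=
  (dirichletGraph N a).toLinearPMap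

theorem dirichletLaplacian_graph (N : ℕ) (a : ℝ) :
    (dirichletLaplacian N a).graph = dirichletGraph N a :=
  Submodule.toLinearPMap_graph_eq _ (dirichletGraph_functional N a)

/-! ### The Hamiltonians -/

/-- `𝒱 = -∑_i Z / r_i + ∑_{i<j} 1 / r_{ij}`. -/
def potential (N : ℕ) (Z : ℝ) (x : Config N) : ℝ :=
  -∑ i, Z / ‖x i‖ + ∑ i, ∑ j with i < j, 1 / ‖x i - x j‖

/-- Multiplication by a real function `V` on its maximal domain `{ψ ∈ L² : V ψ ∈ L²}`. -/
def mulOp {X : Type*} [MeasurableSpace X] (μ : Measure X) (V : X → ℝ) :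
    Lp ℂ 2 μ →ₗ.[ℂ] Lp ℂ 2 μ where
  domain :=
    { carrier := {ψ | MemLp (fun x => (V x : ℂ) * ψ x) 2 μ}
      zero_mem' := by
        refine (MemLp.zero (ε := ℂ) (p := 2) (μ := μ)).ae_eq ?_
        filter_upwards [Lp.coeFn_zero ℂ 2 μ] with x hx
        simp only [hx, Pi.zero_apply, mul_zero]
      add_mem' := fun {u v} hu hv => by
        refine (MemLp.add hu hv).ae_eq ?_
        filter_upwards [Lp.coeFn_add u v] with x hx
        simp only [hx, Pi.add_apply, mul_add]
      smul_mem' := fun c u hu => by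
        refine (MemLp.const_smul hu c).ae_eq ?_
        filter_upwards [Lp.coeFn_smul c u] with x hx
        simp [hx, mul_left_comm] }
  toFun :=
    { toFun := fun ψ => MemLp.toLp _ ψ.2
      map_add' := fun u v => by
        rw [← MemLp.toLp_add]
        refine MemLp.toLp_congr _ _ ?_
        filter_upwards [Lp.coeFn_add (u : Lp ℂ 2 μ) v] with x hx
        simp only [Submodule.coe_add, hx, Pi.add_apply, mul_add]
      map_smul' := fun c u => by
        rw [RingHom.id_apply, ← MemLp.toLp_const_smul]
        refine MemLp.toLp_congr _ _ ?_
        filter_upwards [Lp.coeFn_smul c (u : Lp ℂ 2 μ)] with x hx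
        simp [hx, mul_left_comm] }

/-- Multiplication by `𝒱` on `L²(Ω_a^N)`. -/
def coulomb (N : ℕ) (Z a : ℝ) : L2 N a →ₗ.[ℂ] L2 N a :=
  mulOp (layerMeasure N a) (potential N Z)

/-- `H^a_{N,Z} = -Δ + 𝒱` on `L²(Ω_a^N)`, a priori on the intersection of the domains of the two
summands. -/
def hamiltonian (N : ℕ) (Z a : ℝ) : L2 N a →ₗ.[ℂ] L2 N a :=
  dirichletLaplacian N a + coulomb N Z a

/-- `H̃^a_{N,Z} = a⁻² (-Δ + a 𝒱)` on `L²(Ω_1^N)` for complex `a`, a priori on the intersection of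
the domains of the two summands. -/
def scaledHamiltonian (N : ℕ) (Z : ℝ) (a : ℂ) : L2 N 1 →ₗ.[ℂ] L2 N 1 :=
  (a ^ 2)⁻¹ • (dirichletLaplacian N 1 + a • coulomb N Z 1)

end

end AtomLayer

namespace AtomLayer

noncomputable section

/-! ### Operators parametrized by bounded ones -/

section Parametrized

variable {H : Type*} [NormedAddCommGroup H] [NormedSpace ℂ H] {T : H →ₗ.[ℂ] H} {R M S : H →L[ℂ] H}
  {z : ℂ}

/-! Hardy's inequality bounds `𝒱u` by `∇u` on `H_0^1`. With `R = (-Δ + s)⁻¹` the operator `B = 𝒱R`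
is therefore bounded, and the energy identity gives `‖B‖ ≤ C s^{-1/2}`. Hence the graph of `H̃^a` is
`{(R y, M(a) y)}` with `M(a) = a⁻²(1 - sR + aB)`: `R` is injective and independent of `a`, and `M`
is a bounded analytic family (`IsParametrizedBy`, `IsResolventPair.isParametrizedBy`). This turns
questions about `H̃^a` into questions about bounded operators: `z` lies in the resolvent set iff
`M(a) - zR` is a unit, and the resolvent is then `R (M(a) - zR)⁻¹`. Large `s` and a Neumann series
give a resolvent point. Units form an open set on which inversion is analytic, which gives the Kato
property; type (A) is read off from the fixed domain.

For the eigenvalue, let `ψ₀` be a unit eigenvector at `(a₀, E₀)`. By the functional calculus of a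
real resolvent, `H̃^{a₀} - E₀ + ⟨ψ₀, ·⟩ψ₀` is invertible (`exists_isUnit_bordered`), so for `(a, z)`
near `(a₀, E₀)` the bordered operator has an inverse `Q(a, z)`, analytic in both variables. The rank
one formula shows that `z` is in the spectrum iff the scalar `d(a, z) = 1 - ⟨ψ₀, Q(a, z)ψ₀⟩`
vanishes. Since `d(a₀, E₀) = 0` and `∂_z d(a₀, E₀) = -1`, the implicit function theorem yields
`E(a)`, with eigenvector `Q(a, E(a))ψ₀` (`exists_analytic_eigenvalue`). The zero of `d(a, ·)` is
simple, so the resolvent has a simple pole whose residue has rank one.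

For `a > 0` the dilation `U_a` carries all of this to `H^a`, because `-Δ` and `𝒱` are homogeneous of
degrees `-2` and `-1`. -/

theorem isResolventAt_iff_graph :
    IsResolventAt T z S ↔ (∀ y, (S y, y + z • S y) ∈ T.graph) ∧
      ∀ x w, (x, w) ∈ T.graph → S (w - z • x) = x := by
  constructor
  · rintro ⟨h1, h2⟩
    refine ⟨fun y => ?_, fun x w h => ?_⟩
    · obtain ⟨h, e⟩ := h1 y
      exact (LinearPMap.mem_graph_iff _).2 ⟨⟨S y, h⟩, rfl, sub_eq_iff_eq_add.1 e⟩
    · obtain ⟨x', rfl, rfl⟩ := (LinearPMap.mem_graph_iff _).1 h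
      exact h2 x'
  · rintro ⟨h1, h2⟩
    refine ⟨fun y => ?_, fun x => h2 _ _ (LinearPMap.mem_graph T x)⟩
    obtain ⟨⟨x, hx⟩, e1, e2⟩ := (LinearPMap.mem_graph_iff _).1 (h1 y)
    simp only at e1 e2
    subst e1
    exact ⟨hx, by rw [e2]; abel⟩

theorem opResolvent_eq (h : IsResolventAt T z S) : opResolvent T z = S := by
  have h' : ∃ S, IsResolventAt T z S := ⟨S, h⟩
  rw [opResolvent, dif_pos h']
  exact h'.choose_spec.unique h

/-- A resolvent exhibits the graph as the solution set of the continuous equation `S (w - z x) = x`.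
-/
theorem isClosed_of_isResolventAt (h : IsResolventAt T z S) : T.IsClosed := by
  rw [isResolventAt_iff_graph] at h
  have e : (T.graph : Set (H × H)) = {p | S (p.2 - z • p.1) = p.1} := by
    ext ⟨x, w⟩
    refine ⟨fun hx => h.2 x w hx, fun hx => ?_⟩
    have := h.1 (w - z • x)
    rw [show S (w - z • x) = x from hx] at this
    simpa using this
  rw [LinearPMap.IsClosed, e]
  exact isClosed_eq (by fun_prop) (by fun_prop)

/-- The graph of `T` is `{(R y, M y)}`, where `R` is injective. -/
structure IsParametrizedBy (T : H →ₗ.[ℂ] H) (R M : H →L[ℂ] H) : Prop where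
  injective : Function.Injective R
  mem_graph_iff : ∀ x w, (x, w) ∈ T.graph ↔ ∃ y, R y = x ∧ M y = w

theorem IsParametrizedBy.mem_graph (h : IsParametrizedBy T R M) (y : H) : (R y, M y) ∈ T.graph :=
  (h.mem_graph_iff _ _).2 ⟨y, rfl, rfl⟩

/-- Since `(T - z) R = M - z R`, inverting this bounded operator inverts `T - z`. -/
theorem IsParametrizedBy.isResolventAt (h : IsParametrizedBy T R M) (hu : IsUnit (M - z • R)) :
    IsResolventAt T z (R * Ring.inverse (M - z • R)) := by
  have e1 : ∀ y, (M - z • R) (Ring.inverse (M - z • R) y) = y := fun y => by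
    rw [← mul_apply_eq_comp, Ring.mul_inverse_cancel _ hu, one_apply_eq_self]
  have e2 : ∀ y, Ring.inverse (M - z • R) ((M - z • R) y) = y := fun y => by
    rw [← mul_apply_eq_comp, Ring.inverse_mul_cancel _ hu, one_apply_eq_self]
  rw [isResolventAt_iff_graph]
  refine ⟨fun y => ?_, fun x w hx => ?_⟩
  · rw [mul_apply_eq_comp]
    convert h.mem_graph (Ring.inverse (M - z • R) y) using 2
    have := e1 y
    rw [sub_apply, smul_apply, sub_eq_iff_eq_add] at this
    exact this.symm
  · obtain ⟨y, rfl, rfl⟩ := (h.mem_graph_iff _ _).1 hx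
    have := e2 y
    simp only [sub_apply, smul_apply] at this
    rw [mul_apply_eq_comp, this]

/-- Conversely, `M - z R = (T - z) R` is a bijection, as `R` is a bijection onto the domain; the
bounded inverse theorem makes it a unit. -/
theorem IsParametrizedBy.isUnit [CompleteSpace H] (h : IsParametrizedBy T R M)
    (hz : z ∈ opResolventSet T) : IsUnit (M - z • R) := by
  obtain ⟨S, hS⟩ := hz
  rw [isResolventAt_iff_graph] at hS
  rw [ContinuousLinearMap.isUnit_iff_bijective]
  constructor
  · rw [injective_iff_map_eq_zero]
    intro y hy
    have := hS.2 _ _ (h.mem_graph y)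
    have hy' : M y - z • R y = 0 := hy
    rw [hy', map_zero] at this
    exact h.injective (by rw [← this, map_zero])
  · intro w
    obtain ⟨y, e1, e2⟩ := (h.mem_graph_iff _ _).1 (hS.1 w)
    refine ⟨y, ?_⟩
    simp [e1, e2]

end Parametrized

/-! ### Rank one perturbations -/

section RankOne

variable {H : Type*} [NormedAddCommGroup H] [InnerProductSpace ℂ H] {T : H →ₗ.[ℂ] H}
  {Q : H →L[ℂ] H} {z : ℂ} {ψ₀ : H}

/-- `x ↦ ⟨ψ, x⟩ ψ`. -/
def rankOneProj (ψ : H) : H →L[ℂ] H := (innerSL ℂ ψ).smulRight ψ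

@[simp]
theorem rankOneProj_apply (ψ x : H) : rankOneProj ψ x = inner ℂ ψ x • ψ := by
  simp [rankOneProj]

/-- `Q` is the bounded everywhere defined inverse of `T - z + ⟨ψ₀, ·⟩ ψ₀`. -/
structure IsBorderedInverse (T : H →ₗ.[ℂ] H) (ψ₀ : H) (z : ℂ) (Q : H →L[ℂ] H) : Prop where
  graph : ∀ y, (Q y, y + z • Q y - inner ℂ ψ₀ (Q y) • ψ₀) ∈ T.graph
  left_inv : ∀ x w, (x, w) ∈ T.graph → Q (w - z • x + inner ℂ ψ₀ x • ψ₀) = x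

/-- The same argument with `K = (T - z + ⟨ψ₀, ·⟩ψ₀) R`. -/
theorem IsParametrizedBy.isBorderedInverse {R M : H →L[ℂ] H} (h : IsParametrizedBy T R M)
    (hu : IsUnit (M - z • R + rankOneProj ψ₀ * R)) :
    IsBorderedInverse T ψ₀ z (R * Ring.inverse (M - z • R + rankOneProj ψ₀ * R)) := by
  set K := M - z • R + rankOneProj ψ₀ * R
  have e1 : ∀ y, K (Ring.inverse K y) = y := fun y => by
    rw [← mul_apply_eq_comp, Ring.mul_inverse_cancel _ hu, one_apply_eq_self]
  have e2 : ∀ y, Ring.inverse K (K y) = y := fun y => by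
    rw [← mul_apply_eq_comp, Ring.inverse_mul_cancel _ hu, one_apply_eq_self]
  have eK : ∀ y, K y = M y - z • R y + inner ℂ ψ₀ (R y) • ψ₀ := fun y => by simp [K]
  refine ⟨fun y => ?_, fun x w hx => ?_⟩
  · rw [mul_apply_eq_comp]
    convert h.mem_graph (Ring.inverse K y) using 2
    have := e1 y
    rw [eK, ← eq_sub_iff_add_eq, sub_eq_iff_eq_add] at this
    rw [this]
    module
  · obtain ⟨y, rfl, rfl⟩ := (h.mem_graph_iff _ _).1 hx
    rw [← eK, mul_apply_eq_comp, e2]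

/-- Sherman–Morrison formula: removing the rank one term from `Q⁻¹` costs only division by the
scalar `1 - ⟨ψ₀, Q ψ₀⟩`. -/
theorem IsBorderedInverse.isResolventAt (h : IsBorderedInverse T ψ₀ z Q)
    (hd : 1 - inner ℂ ψ₀ (Q ψ₀) ≠ 0) :
    IsResolventAt T z (Q + (1 - inner ℂ ψ₀ (Q ψ₀))⁻¹ • (Q * rankOneProj ψ₀ * Q)) := by
  set d := 1 - inner ℂ ψ₀ (Q ψ₀) with hd_def
  have hin : inner ℂ ψ₀ (Q ψ₀) = 1 - d := by rw [hd_def]; ring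
  have eS : ∀ y, (Q + d⁻¹ • (Q * rankOneProj ψ₀ * Q)) y
      = Q y + (d⁻¹ * inner ℂ ψ₀ (Q y)) • Q ψ₀ := fun y => by
    simp [smul_smul]
  rw [isResolventAt_iff_graph]
  refine ⟨fun y => ?_, fun x w hx => ?_⟩
  · rw [eS]
    have := T.graph.add_mem (h.graph y)
      (T.graph.smul_mem (d⁻¹ * inner ℂ ψ₀ (Q y)) (h.graph ψ₀))
    convert this using 1
    ext
    · simp
    · simp only [Prod.mk_add_mk, Prod.smul_mk, hin]
      have : (inner ℂ ψ₀ (Q y)) • ψ₀ = (d⁻¹ * inner ℂ ψ₀ (Q y) * d) • ψ₀ := by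
        congr 1; field_simp
      rw [this]
      module
  · have e : Q (w - z • x) = x - inner ℂ ψ₀ x • Q ψ₀ := by
      have := h.left_inv x w hx
      rw [map_add, map_smul] at this
      exact eq_sub_of_add_eq this
    rw [eS, e, inner_sub_right, inner_smul_right, hin]
    have : d⁻¹ * (inner ℂ ψ₀ x - inner ℂ ψ₀ x * (1 - d)) = inner ℂ ψ₀ x := by field_simp; ring
    rw [this]
    simp

theorem IsBorderedInverse.mem_graph (h : IsBorderedInverse T ψ₀ z Q)
    (hd : 1 - inner ℂ ψ₀ (Q ψ₀) = 0) :
    (Q ψ₀, z • Q ψ₀) ∈ T.graph := by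
  have := h.graph ψ₀
  rwa [← sub_eq_zero.1 hd, one_smul, add_sub_cancel_left] at this

/-- If `(T - z) x = 0`, the bordered operator sends `x` to `⟨ψ₀, x⟩ψ₀`, so `x = ⟨ψ₀, x⟩ Q ψ₀`. -/
theorem IsBorderedInverse.eigenspace_eq (h : IsBorderedInverse T ψ₀ z Q)
    (hd : 1 - inner ℂ ψ₀ (Q ψ₀) = 0) :
    eigenspace T z = Submodule.span ℂ {Q ψ₀} := by
  refine le_antisymm (fun x hx => ?_) ?_
  · have := h.left_inv x _ hx
    rw [sub_self, zero_add, map_smul] at this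
    exact Submodule.mem_span_singleton.2 ⟨_, this⟩
  · rw [Submodule.span_singleton_le_iff_mem]
    exact h.mem_graph hd

theorem apply_ne_zero_of_one_sub_inner (hd : 1 - inner ℂ ψ₀ (Q ψ₀) = 0) : Q ψ₀ ≠ 0 := fun h0 => by
  rw [h0, inner_zero_right, sub_zero] at hd
  exact one_ne_zero hd

theorem mem_spec_of_eigenvector {x : H} (hx : x ≠ 0) (hg : (x, z • x) ∈ T.graph) : z ∈ spec T := by
  rintro ⟨S, hS⟩
  have := (isResolventAt_iff_graph.1 hS).2 _ _ hg
  rw [sub_self, map_zero] at this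
  exact hx this.symm

theorem IsBorderedInverse.mem_spec_iff (h : IsBorderedInverse T ψ₀ z Q) :
    z ∈ spec T ↔ 1 - inner ℂ ψ₀ (Q ψ₀) = 0 := by
  refine ⟨fun hz => ?_, fun hd =>
    mem_spec_of_eigenvector (apply_ne_zero_of_one_sub_inner hd) (h.mem_graph hd)⟩
  by_contra hd
  exact hz ⟨_, h.isResolventAt hd⟩

/-- The first resolvent identity; the border is the same at `z` and `w` and cancels. -/
theorem IsBorderedInverse.eq_add_smul (h : IsBorderedInverse T ψ₀ z Q) {w : ℂ} {Q' : H →L[ℂ] H}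
    (h' : IsBorderedInverse T ψ₀ w Q') (y : H) :
    Q' y = Q y + (w - z) • Q (Q' y) := by
  have := h.left_inv _ _ (h'.graph y)
  have e : y + w • Q' y - inner ℂ ψ₀ (Q' y) • ψ₀ - z • Q' y + inner ℂ ψ₀ (Q' y) • ψ₀
      = y + (w - z) • Q' y := by module
  rw [e, map_add, map_smul] at this
  exact this.symm

theorem IsBorderedInverse.inner_apply (h : IsBorderedInverse T ψ₀ z Q) (hz : z.im = 0)
    (hT : ∀ x w x' w', (x, w) ∈ T.graph → (x', w') ∈ T.graph → inner ℂ w x' = inner ℂ x w')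
    (x y : H) : inner ℂ (Q x) y = inner ℂ x (Q y) := by
  have hz' : (starRingEnd ℂ) z = z := Complex.conj_eq_iff_im.2 hz
  have := hT _ _ _ _ (h.graph x) (h.graph y)
  simp only [inner_sub_left, inner_add_left, inner_smul_left, inner_sub_right, inner_add_right,
    inner_smul_right, inner_conj_symm, hz'] at this
  linear_combination -this

end RankOne

/-! ### Rank of the Riesz projection and invertibility of the bordered operator -/

section Perturbation

variable {H : Type*} [NormedAddCommGroup H] [InnerProductSpace ℂ H] [CompleteSpace H]
  {ψ₀ : H}

/-- By `hn` the scalar `1 - ⟨ψ₀, Q z ψ₀⟩` has a simple zero at `c`. The Sherman–Morrison formula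
then shows a simple pole of the resolvent, whose residue `-⟨ψ₀, Q²ψ₀⟩⁻¹ Q ⟨ψ₀, ·⟩ψ₀ Q` at `c` has
rank one. -/
theorem isNondegenerateDiscreteEigenvalue_of_bordered {T : H →ₗ.[ℂ] H} {U : Set ℂ} (hU : IsOpen U)
    {Q : ℂ → H →L[ℂ] H} (hQd : DifferentiableOn ℂ Q U)
    (hQ : ∀ z ∈ U, IsBorderedInverse T ψ₀ z (Q z)) {c : ℂ} (hc : spec T ∩ U = {c})
    (hn : inner ℂ ψ₀ (Q c (Q c ψ₀)) ≠ 0) : IsNondegenerateDiscreteEigenvalue T c := by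
  have hcm : c ∈ spec T ∩ U := by rw [hc]; rfl
  have hcU := hcm.2
  have hd : 1 - inner ℂ ψ₀ (Q c ψ₀) = 0 := (hQ c hcU).mem_spec_iff.1 hcm.1
  obtain ⟨r, hr, hrU⟩ := Metric.nhds_basis_closedBall.mem_iff.1 (hU.mem_nhds hcU)
  -- The resolvent identity between `z` and `c` factors the scalar as `(z - c) h z`. A zero of `h`
  -- off `c` would be a second spectral point in `U`.
  set h : ℂ → ℂ := fun z => -inner ℂ ψ₀ (Q z (Q c ψ₀)) with h_def
  have hdz : ∀ z ∈ U, 1 - inner ℂ ψ₀ (Q z ψ₀) = (z - c) * h z := fun z hz => by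
    have e := congrArg (inner ℂ ψ₀) ((hQ z hz).eq_add_smul (hQ c hcU) ψ₀)
    rw [inner_add_right, inner_smul_right, ← sub_eq_zero.1 hd] at e
    simp only [h_def]
    linear_combination e
  have hh : ∀ z ∈ U, h z ≠ 0 := fun z hz h0 => by
    by_cases hzc : z = c
    · rw [hzc] at h0
      exact hn (neg_eq_zero.1 h0)
    · have : z ∈ spec T ∩ U := ⟨(hQ z hz).mem_spec_iff.2 (by rw [hdz z hz, h0, mul_zero]), hz⟩
      rw [hc] at this
      exact hzc this
  have hhd : DifferentiableOn ℂ h U := by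
    have h1 : DifferentiableOn ℂ (fun z => Q z (Q c ψ₀)) U := hQd.clm_apply (by fun_prop)
    exact (((innerSL ℂ ψ₀).differentiable.comp_differentiableOn h1)).neg
  have hinv : DifferentiableOn ℂ (fun z => (h z)⁻¹) U := hhd.inv hh
  have hQPQ : DifferentiableOn ℂ (fun z => Q z * rankOneProj ψ₀ * Q z) U :=
    (hQd.mul_const _).mul hQd
  -- The resolvent multiplied by `z - c`, extended holomorphically across `c`; Cauchy's formula
  -- evaluates the contour integral as `2πi f(c)`.
  set f : ℂ → H →L[ℂ] H := fun z => (z - c) • Q z + (h z)⁻¹ • (Q z * rankOneProj ψ₀ * Q z)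
    with f_def
  have hf : DifferentiableOn ℂ f (Metric.closedBall c r) := by
    refine DifferentiableOn.mono ?_ hrU
    have : DifferentiableOn ℂ (fun z : ℂ => z - c) U := by fun_prop
    exact (this.smul hQd).add (hinv.smul hQPQ)
  have hint : (∮ z in C(c, r), opResolvent T z) = ∮ z in C(c, r), (z - c)⁻¹ • f z := by
    refine circleIntegral.integral_congr hr.le fun z hz => ?_
    have hzU : z ∈ U := hrU (Metric.sphere_subset_closedBall hz)
    have hzc : z - c ≠ 0 := by
      rw [sub_ne_zero]
      rintro rfl
      simp at hz
      exact hr.ne hz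
    have hne : 1 - inner ℂ ψ₀ (Q z ψ₀) ≠ 0 := by
      rw [hdz z hzU]
      exact mul_ne_zero hzc (hh z hzU)
    rw [opResolvent_eq ((hQ z hzU).isResolventAt hne), hdz z hzU, f_def]
    simp only [smul_add, smul_smul, inv_mul_cancel₀ hzc, one_smul, mul_inv]
  have hR : rieszProjection T c r = (inner ℂ ψ₀ (Q c (Q c ψ₀)))⁻¹ • (Q c * rankOneProj ψ₀ * Q c) := by
    rw [rieszProjection, hint, hf.circleIntegral_sub_inv_smul (Metric.mem_ball_self hr), smul_smul]
    have : -(2 * (Real.pi : ℂ) * Complex.I)⁻¹ * (2 * (Real.pi : ℂ) * Complex.I) = -1 := by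
      rw [neg_mul, inv_mul_cancel₀ Complex.two_pi_I_ne_zero]
    rw [this]
    simp [f_def, h_def, inv_neg]
  refine ⟨r, hr, ?_, ?_⟩
  · refine Set.Subset.antisymm (fun z hz => ?_) ?_
    · rw [← hc]
      exact ⟨hz.1, hrU hz.2⟩
    · rintro _ rfl
      exact ⟨hcm.1, Metric.mem_closedBall_self hr.le⟩
  · have : LinearMap.range (rieszProjection T c r : H →ₗ[ℂ] H) = Submodule.span ℂ {Q c ψ₀} := by
      rw [hR]
      ext x
      rw [LinearMap.mem_range, Submodule.mem_span_singleton]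
      constructor
      · rintro ⟨y, rfl⟩
        exact ⟨(inner ℂ ψ₀ (Q c (Q c ψ₀)))⁻¹ * inner ℂ ψ₀ (Q c y), by simp [smul_smul]⟩
      · rintro ⟨t, rfl⟩
        refine ⟨(t * inner ℂ ψ₀ (Q c (Q c ψ₀))) • ψ₀, ?_⟩
        have h1 : inner ℂ ψ₀ (Q c ψ₀) = 1 := (sub_eq_zero.1 hd).symm
        simp only [smul_apply, mul_apply_eq_comp, ContinuousLinearMap.coe_coe, map_smul,
          rankOneProj_apply, h1, one_smul, smul_smul]
        congr 1
        field_simp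
    rw [this]
    exact finrank_span_singleton (apply_ne_zero_of_one_sub_inner hd)

/-- As `μ` is isolated in the spectrum, its indicator `e` is continuous there and `e(B)` is the
projection onto the eigenspace, hence `⟨ψ₀, ·⟩ψ₀`. The operator is thus the functional calculus of
`(μ - x) + c e(x)`, which never vanishes: it is `c` at `μ` and `μ - x` elsewhere. -/
theorem isUnit_sub_add_rankOneProj {B : H →L[ℂ] H} (hB : IsSelfAdjoint B) {μ c r : ℝ} (hc : c ≠ 0)
    (hr : 0 < r) (hiso : ∀ ν : ℝ, |ν - μ| < r → ν ≠ μ → ν ∉ spectrum ℝ B)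
    (hψ : ‖ψ₀‖ = 1) (hBψ : B ψ₀ = μ • ψ₀) (hker : ∀ x, B x = μ • x → ∃ t : ℂ, x = t • ψ₀) :
    IsUnit (μ • (1 : H →L[ℂ] H) - B + c • rankOneProj ψ₀) := by
  classical
  have hev : ∀ f : ℝ → ℝ, ContinuousOn f {μ}ᶜ → ContinuousOn f (spectrum ℝ B) := by
    intro f hf x hx
    by_cases hxμ : x = μ
    · subst hxμ
      refine (continuousWithinAt_const (b := f x)).congr_of_eventuallyEq_of_mem ?_ hx
      filter_upwards [self_mem_nhdsWithin, mem_nhdsWithin_of_mem_nhds (Metric.ball_mem_nhds x hr)]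
        with y hy hyr
      by_contra hne
      exact hiso y (by simpa [Real.dist_eq] using hyr) (fun h => hne (by rw [h])) hy
    · exact (hf.continuousAt (isOpen_compl_singleton.mem_nhds hxμ)).continuousWithinAt
  set e : ℝ → ℝ := fun x => if x = μ then 1 else 0 with e_def
  have he : ContinuousOn e (spectrum ℝ B) := by
    refine hev e ((continuousOn_const (c := (0 : ℝ))).congr fun x hx => ?_)
    simp [e_def, show x ≠ μ from hx]
  -- With the convention `0⁻¹ = 0`, `g(x)(x - μ) = 1 - e(x)` also at `x = μ`. Hence `(1 - P)ψ₀ =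
  -- g(B)(B - μ)ψ₀ = 0`.
  set g : ℝ → ℝ := fun x => (x - μ)⁻¹
  have hg : ContinuousOn g (spectrum ℝ B) := by
    refine hev g (ContinuousOn.inv₀ (by fun_prop) fun x hx => sub_ne_zero.2 hx)
  set P := cfc e B with P_def
  have hid : cfc (fun x : ℝ => x) B = B := cfc_id' ℝ B
  have hsub : cfc (fun x : ℝ => x - μ) B = B - μ • 1 := by
    rw [cfc_sub (fun x : ℝ => x) (fun _ => μ) B, hid, cfc_const μ B, Algebra.algebraMap_eq_smul_one]
  have hBP : ∀ x, B (P x) = μ • P x := by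
    intro x
    have h1 : B * P = μ • P := by
      rw [P_def, ← cfc_const_mul μ e B he]
      conv_lhs => enter [1]; rw [← hid]
      rw [← cfc_mul (fun x : ℝ => x) e B continuousOn_id he]
      congr 1
      ext x
      by_cases hx : x = μ <;> simp [e_def, hx]
    exact congrArg (fun A : H →L[ℂ] H => A x) h1
  have hPψ : P ψ₀ = ψ₀ := by
    have h1 : cfc g B * (B - μ • 1) = 1 - P := by
      rw [← hsub, ← cfc_mul g (fun x : ℝ => x - μ) B hg (by fun_prop), P_def,
        ← cfc_const_one ℝ B, ← cfc_sub (fun _ => (1 : ℝ)) e B continuousOn_const he]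
      congr 1
      ext x
      by_cases hx : x = μ
      · simp [e_def, g, hx]
      · simp [e_def, g, hx, inv_mul_cancel₀ (sub_ne_zero.2 hx)]
    have h2 := congrArg (fun A : H →L[ℂ] H => A ψ₀) h1
    simp only [mul_apply_eq_comp, sub_apply, smul_apply, one_apply_eq_self, hBψ, sub_self,
      map_zero] at h2
    exact (sub_eq_zero.1 h2.symm).symm
  have hPs : IsSelfAdjoint P := cfc_predicate e B
  have hP : rankOneProj ψ₀ = P := by
    ext x
    obtain ⟨t, ht⟩ := hker _ (hBP x)
    have h1 : inner ℂ ψ₀ (P x) = inner ℂ ψ₀ x := by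
      have := ContinuousLinearMap.isSelfAdjoint_iff_isSymmetric.1 hPs ψ₀ x
      simp only [ContinuousLinearMap.coe_coe, hPψ] at this
      exact this.symm
    rw [rankOneProj_apply, ← h1, ht, inner_smul_right, inner_self_eq_norm_sq_to_K, hψ]
    simp
  have hfin : μ • (1 : H →L[ℂ] H) - B + c • rankOneProj ψ₀ = cfc (fun x => (μ - x) + c * e x) B := by
    rw [cfc_add B (fun x : ℝ => μ - x) (fun x => c * e x) (by fun_prop) (continuousOn_const.mul he),
      cfc_const_mul c e B he, hP, cfc_sub (fun _ => μ) (fun x : ℝ => x) B, hid, cfc_const μ B,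
      Algebra.algebraMap_eq_smul_one]
  rw [hfin, isUnit_cfc_iff (fun x => (μ - x) + c * e x) B
    ((by fun_prop : ContinuousOn (fun x : ℝ => μ - x) _).add (continuousOn_const.mul he)) hB]
  intro x _
  by_cases hx : x = μ
  · simp [e_def, hx, hc]
  · simpa [e_def, hx] using sub_ne_zero.2 (Ne.symm hx)

end Perturbation

/-! ### Symmetric operators: from an isolated simple eigenvalue to an invertible bordered operator
-/

section Perturbation

variable {H : Type*} [NormedAddCommGroup H] [InnerProductSpace ℂ H]

/-- `T` is symmetric, in terms of its graph. -/
def IsGraphSymmetric (T : H →ₗ.[ℂ] H) : Prop :=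
  ∀ x w x' w', (x, w) ∈ T.graph → (x', w') ∈ T.graph → inner ℂ w x' = inner ℂ x w'

theorem IsGraphSymmetric.im_eq_zero {T : H →ₗ.[ℂ] H} (hT : IsGraphSymmetric T) {x : H} {z : ℂ}
    (hx : x ≠ 0) (h : (x, z • x) ∈ T.graph) : z.im = 0 := by
  have := hT _ _ _ _ h h
  rw [inner_smul_left, inner_smul_right] at this
  exact Complex.conj_eq_iff_im.1 (mul_right_cancel₀ (inner_self_ne_zero.2 hx) this)

theorem IsGraphSymmetric.isSelfAdjoint_resolvent [CompleteSpace H] {T : H →ₗ.[ℂ] H}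
    (hT : IsGraphSymmetric T)
    {z : ℝ} {S : H →L[ℂ] H} (hS : IsResolventAt T z S) : IsSelfAdjoint S := by
  rw [ContinuousLinearMap.isSelfAdjoint_iff_isSymmetric]
  intro x y
  have hg := (isResolventAt_iff_graph.1 hS).1
  have := hT _ _ _ _ (hg x) (hg y)
  simp only [inner_add_left, inner_smul_left, inner_add_right, inner_smul_right,
    Complex.conj_ofReal] at this
  simp only [ContinuousLinearMap.coe_coe]
  linear_combination -this

/-- The resolvent `B` at the real point `z₀` is bounded and self-adjoint, and `l ↦ (l - z₀)⁻¹`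
carries `E₀` to an isolated simple eigenvalue `μ` of `B`. The bounded lemma applies to `B`, and a
factorization brings the result back to `T`. -/
theorem exists_isUnit_bordered [CompleteSpace H] {T : H →ₗ.[ℂ] H} {R M : H →L[ℂ] H}
    (hT : IsParametrizedBy T R M)
    (hs : IsGraphSymmetric T) {z₀ : ℝ} (hz₀ : (z₀ : ℂ) ∈ opResolventSet T) {E₀ : ℂ}
    (hE₀ : IsSimpleIsolatedEigenvalue T E₀) :
    ∃ ψ₀ : H, ‖ψ₀‖ = 1 ∧ (ψ₀, E₀ • ψ₀) ∈ T.graph ∧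
      IsUnit (M - E₀ • R + rankOneProj ψ₀ * R) := by
  obtain ⟨⟨r, hr, hiso⟩, hfin⟩ := hE₀
  obtain ⟨⟨v, hv⟩, hv0, hspan⟩ := finrank_eq_one_iff'.1 hfin
  have hv0' : v ≠ 0 := fun h => hv0 (by ext; exact h)
  obtain ⟨e, rfl⟩ : ∃ e : ℝ, E₀ = e :=
    ⟨E₀.re, Complex.ext rfl (hs.im_eq_zero hv0' hv)⟩
  set ψ₀ : H := ((‖v‖⁻¹ : ℝ) : ℂ) • v with ψ₀_def
  have hvn : ‖v‖ ≠ 0 := norm_ne_zero_iff.2 hv0'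
  have hψg : (ψ₀, (e : ℂ) • ψ₀) ∈ T.graph := (eigenspace T (e : ℂ)).smul_mem _ hv
  have hψn : ‖ψ₀‖ = 1 := by
    rw [ψ₀_def, norm_smul, Complex.norm_real, norm_inv, norm_norm, inv_mul_cancel₀ hvn]
  have hker : ∀ x, (x, (e : ℂ) • x) ∈ T.graph → ∃ t : ℂ, x = t • ψ₀ := by
    intro x hx
    obtain ⟨t, ht⟩ := hspan ⟨x, hx⟩
    refine ⟨t * ‖v‖, ?_⟩
    have : t • v = x := congrArg Subtype.val ht
    rw [← this, ψ₀_def, smul_smul, mul_assoc, ← Complex.ofReal_mul, mul_inv_cancel₀ hvn]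
    simp
  refine ⟨ψ₀, hψn, hψg, ?_⟩
  have hne : e - z₀ ≠ 0 := by
    intro h0
    rw [sub_eq_zero] at h0
    have : (e : ℂ) ∈ spec T ∩ Metric.ball (e : ℂ) r := by rw [hiso]; rfl
    exact this.1 (by rwa [h0])
  have hC := hT.isUnit hz₀
  set C := M - (z₀ : ℂ) • R with C_def
  have hB := hT.isResolventAt (z := (z₀ : ℂ)) hC
  set B := R * Ring.inverse C with B_def
  have hBC : B * C = R := by rw [B_def, mul_assoc, Ring.inverse_mul_cancel _ hC, mul_one]
  have hBs := hs.isSelfAdjoint_resolvent hB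
  have hBg := isResolventAt_iff_graph.1 hB
  set μ := (e - z₀)⁻¹ with μ_def
  have hμ : μ ≠ 0 := inv_ne_zero hne
  have hBψ : B ψ₀ = μ • ψ₀ := by
    have h1 := hBg.2 _ _ hψg
    rw [← sub_smul, ← Complex.ofReal_sub, map_smul, Complex.coe_smul] at h1
    rw [μ_def]
    exact (inv_smul_eq_iff₀ hne).2 h1.symm |>.symm
  have hBker : ∀ x, B x = μ • x → ∃ t : ℂ, x = t • ψ₀ := by
    intro x hx
    refine hker x ?_
    have h1 := T.graph.smul_mem ((μ⁻¹ : ℝ) : ℂ) (hBg.1 x)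
    rw [hx] at h1
    convert h1 using 1
    have h2 : ((e - z₀ : ℝ) : ℂ) ≠ 0 := by exact_mod_cast hne
    push_cast at h2
    ext
    · simp only [Prod.smul_mk, Complex.coe_smul]
      rw [smul_smul, inv_mul_cancel₀ hμ, one_smul]
    · simp only [Prod.smul_mk, smul_add, ← Complex.coe_smul, smul_smul]
      rw [← add_smul]
      congr 1
      rw [μ_def]
      push_cast
      field_simp
      ring
  -- A real `ν ≠ 0` corresponds to `z₀ + ν⁻¹`, and `ν - B = ν (M - (z₀ + ν⁻¹)R) C⁻¹`.
  have hBiso : ∃ ρ > 0, ∀ ν : ℝ, |ν - μ| < ρ → ν ≠ μ → ν ∉ spectrum ℝ B := by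
    have hcont : ContinuousAt (fun ν : ℝ => ((z₀ + ν⁻¹ : ℝ) : ℂ)) μ :=
      Complex.continuous_ofReal.continuousAt.comp
        (continuousAt_const.add (continuousAt_inv₀ hμ))
    have hval : ((z₀ + μ⁻¹ : ℝ) : ℂ) = e := by rw [μ_def, inv_inv]; simp
    have h1 : ∀ᶠ ν : ℝ in 𝓝 μ, ((z₀ + ν⁻¹ : ℝ) : ℂ) ∈ Metric.ball (e : ℂ) r ∧ ν ≠ 0 := by
      refine (hcont.eventually_mem ?_).and (eventually_ne_nhds hμ)
      rw [hval]
      exact Metric.ball_mem_nhds _ hr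
    obtain ⟨ρ, hρ, h2⟩ := Metric.eventually_nhds_iff.1 h1
    refine ⟨ρ, hρ, fun ν hν hνμ hmem => ?_⟩
    obtain ⟨h3, h4⟩ := h2 (by simpa [Real.dist_eq] using hν)
    have h5 : ((z₀ + ν⁻¹ : ℝ) : ℂ) ∈ opResolventSet T := by
      by_contra h6
      have : ((z₀ + ν⁻¹ : ℝ) : ℂ) ∈ spec T ∩ Metric.ball (e : ℂ) r := ⟨h6, h3⟩
      rw [hiso, Set.mem_singleton_iff, ← hval, Complex.ofReal_inj, add_right_inj, inv_inj] at this
      exact hνμ this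
    have h6 := hT.isUnit h5
    rw [spectrum.mem_iff] at hmem
    refine hmem ?_
    have h7 : ν • ((1 : H →L[ℂ] H) * C - (ν⁻¹ • (B * C))) * Ring.inverse C
        = algebraMap ℝ (H →L[ℂ] H) ν - B := by
      rw [Algebra.algebraMap_eq_smul_one, smul_sub, smul_smul, mul_inv_cancel₀ h4, one_smul, sub_mul,
        smul_mul_assoc, mul_assoc, mul_assoc, Ring.mul_inverse_cancel _ hC, mul_one, mul_one]
    have h8 : M - ((z₀ + ν⁻¹ : ℝ) : ℂ) • R = (1 : H →L[ℂ] H) * C - (ν⁻¹ • (B * C)) := by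
      rw [hBC, one_mul, C_def, ← Complex.coe_smul ν⁻¹]
      push_cast
      module
    rw [← h7, ← h8]
    refine IsUnit.mul ?_ (hC.ringInverse)
    exact (isUnit_smul_iff (Units.mk0 ν h4) _).2 h6
  obtain ⟨ρ, hρ, hBiso⟩ := hBiso
  -- The coefficient `μ²` is forced by the factorization `hfin`: one factor cancels `e - z₀ = μ⁻¹`,
  -- the other turns `⟨ψ₀, ·⟩ψ₀` into `⟨ψ₀, B ·⟩ψ₀`, and `B C = R`.
  have hu := isUnit_sub_add_rankOneProj hBs (pow_ne_zero 2 hμ) hρ hBiso hψn hBψ hBker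
  have hPB : rankOneProj ψ₀ * B = μ • rankOneProj ψ₀ := by
    ext x
    have h1 := ContinuousLinearMap.isSelfAdjoint_iff_isSymmetric.1 hBs ψ₀ x
    simp only [ContinuousLinearMap.coe_coe, hBψ, ← Complex.coe_smul, inner_smul_left,
      Complex.conj_ofReal] at h1
    simp only [mul_apply_eq_comp, rankOneProj_apply, smul_apply, ← h1, ← Complex.coe_smul,
      smul_smul]
  have hfin : M - (e : ℂ) • R + rankOneProj ψ₀ * R
      = ((e - z₀) • (μ • (1 : H →L[ℂ] H) - B + μ ^ 2 • rankOneProj ψ₀)) * C := by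
    rw [smul_mul_assoc, add_mul, sub_mul, hBC, smul_mul_assoc, smul_mul_assoc, one_mul, pow_two,
      mul_smul, ← smul_mul_assoc μ (rankOneProj ψ₀), ← hPB, mul_assoc, hBC, smul_add, smul_sub,
      smul_smul, smul_smul, μ_def, mul_inv_cancel₀ hne, one_smul, one_smul, C_def,
      ← Complex.coe_smul (e - z₀)]
    push_cast
    module
  rw [hfin]
  exact ((isUnit_smul_iff (Units.mk0 _ hne) _).2 hu).mul hC

end Perturbation

/-! ### Analytic continuation of a simple eigenvalue -/

section Perturbation

variable {H : Type*} [NormedAddCommGroup H] [InnerProductSpace ℂ H]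

theorem analyticAt_clm_apply {X : Type*} [NormedAddCommGroup X] [NormedSpace ℂ X]
    {A : X → H →L[ℂ] H} {v : X → H} {p : X} (hA : AnalyticAt ℂ A p) (hv : AnalyticAt ℂ v p) :
    AnalyticAt ℂ (fun p => A p (v p)) p :=
  ((ContinuousLinearMap.id ℂ (H →L[ℂ] H)).analyticAt_bilinear (A p, v p)).comp₂ hA hv

theorem isSimpleIsolatedEigenvalue_of_bordered {T : H →ₗ.[ℂ] H} {U : Set ℂ} (hU : IsOpen U) {c : ℂ}
    {Q : H →L[ℂ] H} {ψ₀ : H} (hQ : IsBorderedInverse T ψ₀ c Q) (hc : spec T ∩ U = {c}) :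
    IsSimpleIsolatedEigenvalue T c := by
  have hcm : c ∈ spec T ∩ U := by rw [hc]; rfl
  obtain ⟨r, hr, hrU⟩ := Metric.isOpen_iff.1 hU c hcm.2
  have hd := hQ.mem_spec_iff.1 hcm.1
  refine ⟨⟨r, hr, Set.Subset.antisymm (fun z hz => ?_) ?_⟩, ?_⟩
  · rw [← hc]
    exact ⟨hz.1, hrU hz.2⟩
  · rintro _ rfl
    exact ⟨hcm.1, Metric.mem_ball_self hr⟩
  · rw [hQ.eigenspace_eq hd]
    exact finrank_span_singleton (apply_ne_zero_of_one_sub_inner hd)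

/-- The spectrum near `(a₀, E₀)` is the zero set of one scalar analytic function of `(a, z)`, to
which the implicit function theorem applies. Symmetry for real `a` is used to border at `a₀`, to
make `E a` real and to normalize the eigenvector. -/
theorem exists_analytic_eigenvalue [CompleteSpace H] {T : ℂ → H →ₗ.[ℂ] H} {R : H →L[ℂ] H}
    {M : ℂ → H →L[ℂ] H} {O : Set ℂ} (hO : IsOpen O) (hM : AnalyticOnNhd ℂ M O)
    (hT : ∀ a ∈ O, IsParametrizedBy (T a) R (M a))
    (hs : ∀ a : ℝ, (a : ℂ) ∈ O → IsGraphSymmetric (T a)) {a₀ z₀ : ℝ} (ha₀ : (a₀ : ℂ) ∈ O)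
    (hz₀ : (z₀ : ℂ) ∈ opResolventSet (T a₀)) {E₀ : ℂ}
    (hE₀ : IsSimpleIsolatedEigenvalue (T a₀) E₀) :
    ∃ δ > 0, ∃ ε > 0, ∃ (E : ℂ → ℂ) (Ψ : ℂ → H),
      AnalyticOnNhd ℂ E (Metric.ball (a₀ : ℂ) δ) ∧
      AnalyticOnNhd ℂ Ψ (Metric.ball (a₀ : ℂ) δ) ∧
      E a₀ = E₀ ∧
      (∀ a ∈ Metric.ball (a₀ : ℂ) δ, a ∈ O ∧
        spec (T a) ∩ Metric.ball E₀ ε = {E a} ∧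
        IsNondegenerateDiscreteEigenvalue (T a) (E a) ∧
        Ψ a ≠ 0 ∧ (Ψ a, E a • Ψ a) ∈ (T a).graph) ∧
      ∀ a : ℝ, (a : ℂ) ∈ Metric.ball (a₀ : ℂ) δ →
        IsSimpleIsolatedEigenvalue (T a) (E a) ∧ (E a).im = 0 ∧ ‖Ψ a‖ = 1 := by
  obtain ⟨ψ₀, hψn, hψg, hu₀⟩ := exists_isUnit_bordered (hT _ ha₀) (hs _ ha₀) hz₀ hE₀
  have hψi : inner ℂ ψ₀ ψ₀ = (1 : ℂ) := by rw [inner_self_eq_norm_sq_to_K, hψn]; simp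
  set K : ℂ × ℂ → H →L[ℂ] H := fun p => M p.1 - p.2 • R + rankOneProj ψ₀ * R with K_def
  set Q : ℂ × ℂ → H →L[ℂ] H := fun p => R * Ring.inverse (K p) with Q_def
  set p₀ : ℂ × ℂ := ((a₀ : ℂ), E₀) with p₀_def
  have hKan : ∀ p : ℂ × ℂ, p.1 ∈ O → AnalyticAt ℂ K p := fun p hp => by
    have h1 : AnalyticAt ℂ (fun p : ℂ × ℂ => M p.1) p := (hM _ hp).comp analyticAt_fst
    exact (h1.sub (analyticAt_snd.smul analyticAt_const)).add analyticAt_const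
  have hQan : ∀ p : ℂ × ℂ, p.1 ∈ O → IsUnit (K p) → AnalyticAt ℂ Q p := fun p hp hup => by
    have h1 : AnalyticAt ℂ (fun p => Ring.inverse (K p)) p :=
      AnalyticAt.comp (g := Ring.inverse) (analyticAt_inverse hup.unit) (hKan p hp)
    exact analyticAt_const.mul h1
  have hQb : ∀ p : ℂ × ℂ, p.1 ∈ O → IsUnit (K p) → IsBorderedInverse (T p.1) ψ₀ p.2 (Q p) :=
    fun p hp hup => (hT _ hp).isBorderedInverse hup
  have hQψ : Q p₀ ψ₀ = ψ₀ := by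
    have := (hQb p₀ ha₀ hu₀).left_inv _ _ hψg
    rwa [hψi, one_smul, sub_self, zero_add] at this
  have hinn : ∀ {X : Type} [NormedAddCommGroup X] [NormedSpace ℂ X] (v : X → H) (p : X),
      AnalyticAt ℂ v p → AnalyticAt ℂ (fun p => inner ℂ ψ₀ (v p)) p := fun v p hv =>
    ((innerSL ℂ ψ₀).analyticAt _).comp hv
  set d : ℂ × ℂ → ℂ := fun p => 1 - inner ℂ ψ₀ (Q p ψ₀) with d_def
  have hdan : ∀ p : ℂ × ℂ, p.1 ∈ O → IsUnit (K p) → AnalyticAt ℂ d p := fun p hp hup =>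
    analyticAt_const.sub (hinn _ _ (analyticAt_clm_apply (hQan p hp hup) analyticAt_const))
  have hd₀ : d p₀ = 0 := by rw [d_def]; simp only [hQψ, hψi, sub_self]
  have hgood : ∀ᶠ p in 𝓝 p₀, p.1 ∈ O ∧ IsUnit (K p) := by
    refine (continuousAt_fst.eventually_mem (hO.mem_nhds ha₀)).and ?_
    exact (hKan p₀ ha₀).continuousAt.eventually_mem (Units.isOpen.mem_nhds hu₀)
  have hcd : ContDiffAt ℂ ⊤ d p₀ := (hdan p₀ ha₀ hu₀).contDiffAt
  have hline : HasDerivAt (fun z => ((a₀ : ℂ), z)) ((0 : ℂ), (1 : ℂ)) E₀ :=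
    (hasDerivAt_const _ _).prodMk (hasDerivAt_id _)
  have hgoodline : ∀ᶠ z in 𝓝 E₀, IsUnit (K (a₀, z)) :=
    (hline.continuousAt.eventually hgood).mono fun z hz => hz.2
  -- Along `a = a₀` the resolvent identity and `Q p₀ ψ₀ = ψ₀` give `d = (z - E₀)(-⟨ψ₀, Q(a₀,
  -- z)ψ₀⟩)`, so the derivative at `E₀` is `-‖ψ₀‖²`.
  have hderiv : fderiv ℂ d p₀ (0, 1) = -1 := by
    have h1 : HasDerivAt (fun z => d (a₀, z)) (fderiv ℂ d p₀ (0, 1)) E₀ :=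
      (hdan p₀ ha₀ hu₀).differentiableAt.hasFDerivAt.comp_hasDerivAt (f := fun z => ((a₀ : ℂ), z))
        E₀ hline
    have h2 : HasDerivAt (fun z => (z - E₀) * -inner ℂ ψ₀ (Q (a₀, z) ψ₀)) (-1) E₀ := by
      have h3 : DifferentiableAt ℂ (fun z => -inner ℂ ψ₀ (Q (a₀, z) ψ₀)) E₀ := by
        have h4 := hinn _ _ (analyticAt_clm_apply (hQan p₀ ha₀ hu₀) (analyticAt_const (v := ψ₀)))
        exact (DifferentiableAt.comp (f := fun z => ((a₀ : ℂ), z)) E₀ h4.differentiableAt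
          hline.differentiableAt).neg
      refine (((hasDerivAt_id E₀).sub_const E₀).mul h3.hasDerivAt).congr_deriv ?_
      have : Q (a₀, E₀) ψ₀ = ψ₀ := hQψ
      rw [this, hψi]
      simp
    refine h1.unique (h2.congr_of_eventuallyEq ?_)
    filter_upwards [hgoodline] with z hz
    have e := congrArg (inner ℂ ψ₀) ((hQb (a₀, z) ha₀ hz).eq_add_smul (hQb p₀ ha₀ hu₀) ψ₀)
    rw [hQψ, inner_add_right, inner_smul_right, hψi] at e
    simp only [d_def]
    linear_combination e
  have hinv : (fderiv ℂ d p₀ ∘L .inr ℂ ℂ ℂ).IsInvertible := by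
    refine ⟨ContinuousLinearEquiv.unitsEquivAut ℂ (Units.mk0 (-1) (by norm_num)), ?_⟩
    ext
    simp [hderiv]
  set E := hcd.implicitFunction (by simp) hinv with E_def
  have hE₀' : E a₀ = E₀ := hcd.implicitFunction_apply_self (by simp) hinv
  have hEan : AnalyticAt ℂ E a₀ := (hcd.contDiffAt_implicitFunction (by simp) hinv).analyticAt
  have hEiff : ∀ᶠ p in 𝓝 p₀, d p = 0 ↔ E p.1 = p.2 := by
    have := hcd.eventually_apply_eq_iff_implicitFunction (by simp) hinv
    rwa [hd₀] at this
  set Q₁ : ℂ → H →L[ℂ] H := fun a => Q (a, E a) with Q₁_def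
  -- `n` has two uses: `n a ≠ 0` makes the zero of `d(a, ·)` simple, and for real `a` it equals `‖Q₁
  -- a ψ₀‖²`, so that `n^{-1/2}` is an analytic normalization. Values in the slit plane serve both.
  set n : ℂ → ℂ := fun a => inner ℂ ψ₀ (Q₁ a (Q₁ a ψ₀)) with n_def
  have hQ₁an : AnalyticAt ℂ Q₁ a₀ := by
    refine AnalyticAt.comp (g := Q) (f := fun a => (a, E a)) ?_ (analyticAt_id.prod hEan)
    rw [hE₀']
    exact hQan p₀ ha₀ hu₀
  have hQ₁ψ : Q₁ a₀ ψ₀ = ψ₀ := by rw [Q₁_def]; simp only [hE₀']; exact hQψ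
  have hnan : AnalyticAt ℂ n a₀ :=
    hinn _ _ (analyticAt_clm_apply hQ₁an (analyticAt_clm_apply hQ₁an analyticAt_const))
  have hn₀ : n a₀ = 1 := by rw [n_def]; simp only [hQ₁ψ, hψi]
  obtain ⟨η, hη, hball⟩ := Metric.eventually_nhds_iff_ball.1 (hgood.and hEiff)
  have hnear : ∀ᶠ a in 𝓝 (a₀ : ℂ), a ∈ Metric.ball (a₀ : ℂ) η ∧ E a ∈ Metric.ball E₀ η ∧
      AnalyticAt ℂ E a ∧ AnalyticAt ℂ Q₁ a ∧ AnalyticAt ℂ n a ∧ n a ∈ Complex.slitPlane := by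
    refine (Filter.Eventually.and (Metric.ball_mem_nhds _ hη)) ((hEan.continuousAt.eventually_mem ?_).and
      (hEan.eventually_analyticAt.and (hQ₁an.eventually_analyticAt.and
      (hnan.eventually_analyticAt.and (hnan.continuousAt.eventually_mem ?_)))))
    · rw [hE₀']
      exact Metric.ball_mem_nhds _ hη
    · rw [hn₀]
      exact Complex.isOpen_slitPlane.mem_nhds Complex.one_mem_slitPlane
  obtain ⟨δ, hδ, hδball⟩ := Metric.eventually_nhds_iff_ball.1 hnear
  -- Balls of `ℂ × ℂ` are products of discs, so one radius `η` in `z` works for every `a` and serves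
  -- as `ε`.
  have hprod : ∀ a ∈ Metric.ball (a₀ : ℂ) δ, ∀ z ∈ Metric.ball E₀ η,
      (a ∈ O ∧ IsUnit (K (a, z))) ∧ (d (a, z) = 0 ↔ E a = z) := fun a ha z hz =>
    hball (a, z) (by
      rw [p₀_def, ← ball_prod_same]
      exact ⟨(hδball a ha).1, hz⟩)
  have hspec : ∀ a ∈ Metric.ball (a₀ : ℂ) δ, spec (T a) ∩ Metric.ball E₀ η = {E a} := by
    intro a ha
    ext z
    rw [Set.mem_singleton_iff]
    constructor
    · rintro ⟨hz, hzη⟩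
      obtain ⟨⟨h1, h2⟩, h3⟩ := hprod a ha z hzη
      exact (h3.1 ((hQb (a, z) h1 h2).mem_spec_iff.1 hz)).symm
    · rintro rfl
      have hzη := (hδball a ha).2.1
      obtain ⟨⟨h1, h2⟩, h3⟩ := hprod a ha _ hzη
      exact ⟨(hQb (a, E a) h1 h2).mem_spec_iff.2 (h3.2 rfl), hzη⟩
  have hQ₁b : ∀ a ∈ Metric.ball (a₀ : ℂ) δ, IsBorderedInverse (T a) ψ₀ (E a) (Q₁ a) := by
    intro a ha
    obtain ⟨⟨h1, h2⟩, -⟩ := hprod a ha _ (hδball a ha).2.1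
    exact hQb (a, E a) h1 h2
  have hd₁ : ∀ a ∈ Metric.ball (a₀ : ℂ) δ, 1 - inner ℂ ψ₀ (Q₁ a ψ₀) = 0 := by
    intro a ha
    exact (hprod a ha _ (hδball a ha).2.1).2.2 rfl
  have hn0 : ∀ a ∈ Metric.ball (a₀ : ℂ) δ, n a ≠ 0 := fun a ha =>
    Complex.slitPlane_ne_zero (hδball a ha).2.2.2.2.2
  refine ⟨δ, hδ, η, hη, E, fun a => (n a) ^ (-(1 / 2) : ℂ) • Q₁ a ψ₀,
    fun a ha => (hδball a ha).2.2.1, fun a ha => ?_, hE₀', fun a ha => ?_, fun a ha => ?_⟩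
  · obtain ⟨-, -, -, h4, h5, h6⟩ := hδball a ha
    exact (h5.cpow analyticAt_const h6).smul (analyticAt_clm_apply h4 analyticAt_const)
  · refine ⟨(hprod a ha _ (hδball a ha).2.1).1.1, hspec a ha, ?_, ?_, ?_⟩
    · refine isNondegenerateDiscreteEigenvalue_of_bordered Metric.isOpen_ball (ψ₀ := ψ₀)
        (Q := fun z => Q (a, z)) (fun z hz => ?_) (fun z hz => ?_) (hspec a ha) (hn0 a ha)
      · obtain ⟨⟨h1, h2⟩, -⟩ := hprod a ha z hz
        have h3 : DifferentiableAt ℂ (fun z : ℂ => (a, z)) z := by fun_prop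
        exact (DifferentiableAt.comp (f := fun z => (a, z)) z (hQan (a, z) h1 h2).differentiableAt
          h3).differentiableWithinAt
      · obtain ⟨⟨h1, h2⟩, -⟩ := hprod a ha z hz
        exact hQb (a, z) h1 h2
    · refine smul_ne_zero ?_ (apply_ne_zero_of_one_sub_inner (hd₁ a ha))
      rw [Complex.cpow_ne_zero_iff]
      exact Or.inl (hn0 a ha)
    · have := (T a).graph.smul_mem ((n a) ^ (-(1 / 2) : ℂ)) ((hQ₁b a ha).mem_graph (hd₁ a ha))
      rwa [Prod.smul_mk, smul_comm] at this
  · have haO : (a : ℂ) ∈ O := (hprod a ha _ (hδball a ha).2.1).1.1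
    have him : (E a).im = 0 := (hs a haO).im_eq_zero
      (apply_ne_zero_of_one_sub_inner (hd₁ a ha)) ((hQ₁b a ha).mem_graph (hd₁ a ha))
    refine ⟨isSimpleIsolatedEigenvalue_of_bordered Metric.isOpen_ball (hQ₁b a ha) (hspec a ha),
      him, ?_⟩
    -- As `E a` is real, `Q₁ a` is symmetric and can be moved to the other side of the inner
    -- product.
    have hna : n a = ((‖Q₁ a ψ₀‖ ^ 2 : ℝ) : ℂ) := by
      simp only [n_def]
      rw [← (hQ₁b a ha).inner_apply him (hs a haO), inner_self_eq_norm_sq_to_K]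
      simp
    have hpos : 0 < ‖Q₁ a ψ₀‖ := norm_pos_iff.2 (apply_ne_zero_of_one_sub_inner (hd₁ a ha))
    rw [norm_smul, hna, Complex.norm_cpow_eq_rpow_re_of_pos (by positivity)]
    have : (-(1 / 2) : ℂ).re = -(1 / 2 : ℝ) := by simp
    rw [this, Real.rpow_neg (by positivity), ← Real.sqrt_eq_rpow, Real.sqrt_sq hpos.le,
      inv_mul_cancel₀ hpos.ne']

end Perturbation

/-! ### Analyticity of the resolvent in the parameter -/

section Families

variable {H : Type*} [NormedAddCommGroup H] [NormedSpace ℂ H] [CompleteSpace H]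

/-- The resolvent is `R (M a - z R)⁻¹`; units are open and inversion is analytic on them. -/
theorem IsParametrizedBy.analyticAt_opResolvent {T : ℂ → H →ₗ.[ℂ] H} {R : H →L[ℂ] H}
    {M : ℂ → H →L[ℂ] H} {O : Set ℂ} (hO : IsOpen O) (hM : AnalyticOnNhd ℂ M O)
    (hT : ∀ a ∈ O, IsParametrizedBy (T a) R (M a)) {b z : ℂ} (hb : b ∈ O)
    (hz : z ∈ opResolventSet (T b)) :
    (∀ᶠ a in 𝓝 b, z ∈ opResolventSet (T a)) ∧ AnalyticAt ℂ (fun a => opResolvent (T a) z) b := by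
  have hu := (hT b hb).isUnit hz
  have hF : AnalyticAt ℂ (fun a => M a - z • R) b := (hM b hb).sub analyticAt_const
  have hev : ∀ᶠ a in 𝓝 b, IsResolventAt (T a) z (R * Ring.inverse (M a - z • R)) := by
    filter_upwards [hO.mem_nhds hb,
      hF.continuousAt.eventually_mem (Units.isOpen.mem_nhds hu)] with a ha hua
    exact (hT a ha).isResolventAt hua
  refine ⟨hev.mono fun a ha => ⟨_, ha⟩, ?_⟩
  have han : AnalyticAt ℂ (fun a => R * Ring.inverse (M a - z • R)) b :=
    analyticAt_const.mul
      (AnalyticAt.comp (g := Ring.inverse) (analyticAt_inverse hu.unit) hF)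
  exact han.congr (hev.mono fun a ha => (opResolvent_eq ha).symm)

end Families

/-! ### Invariance of spectrum and eigenspaces under equivalence -/

section UnitaryEquivalence

variable {H H' : Type*} [NormedAddCommGroup H] [NormedSpace ℂ H] [NormedAddCommGroup H']
  [NormedSpace ℂ H'] {T : H →ₗ.[ℂ] H} {T' : H' →ₗ.[ℂ] H'}

theorem opResolventSet_subset_of_equiv (U : H ≃L[ℂ] H')
    (hU : ∀ x w, (x, w) ∈ T.graph ↔ (U x, U w) ∈ T'.graph) :
    opResolventSet T ⊆ opResolventSet T' := by
  rintro z ⟨S, hS⟩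
  rw [isResolventAt_iff_graph] at hS
  refine ⟨(U : H →L[ℂ] H') ∘L S ∘L (U.symm : H' →L[ℂ] H), isResolventAt_iff_graph.2
    ⟨fun y => ?_, fun x w hx => ?_⟩⟩
  · have := (hU _ _).1 (hS.1 (U.symm y))
    simpa using this
  · have h1 : (U.symm x, U.symm w) ∈ T.graph := (hU _ _).2 (by simpa using hx)
    have := congrArg U (hS.2 _ _ h1)
    simpa using this

theorem spec_eq_of_equiv (U : H ≃L[ℂ] H')
    (hU : ∀ x w, (x, w) ∈ T.graph ↔ (U x, U w) ∈ T'.graph) : spec T = spec T' := by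
  rw [spec, spec, compl_inj_iff]
  exact (opResolventSet_subset_of_equiv U hU).antisymm
    (opResolventSet_subset_of_equiv U.symm fun x w => by simp [hU])

theorem finrank_eigenspace_eq_of_equiv (U : H ≃L[ℂ] H')
    (hU : ∀ x w, (x, w) ∈ T.graph ↔ (U x, U w) ∈ T'.graph) (l : ℂ) :
    Module.finrank ℂ (eigenspace T l) = Module.finrank ℂ (eigenspace T' l) := by
  have h : (eigenspace T l).map (U.toLinearEquiv : H →ₗ[ℂ] H') = eigenspace T' l := by
    ext x
    rw [Submodule.mem_map]
    constructor
    · rintro ⟨y, hy, rfl⟩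
      have := (hU _ _).1 (show (y, l • y) ∈ T.graph from hy)
      rw [map_smul] at this
      exact this
    · intro hx
      refine ⟨U.symm x, (hU _ _).2 ?_, by simp⟩
      simpa using show (x, l • x) ∈ T'.graph from hx
  rw [← h]
  exact (LinearEquiv.finrank_map_eq U.toLinearEquiv _).symm

theorem isSimpleIsolatedEigenvalue_iff_of_equiv (U : H ≃L[ℂ] H')
    (hU : ∀ x w, (x, w) ∈ T.graph ↔ (U x, U w) ∈ T'.graph) (l : ℂ) :
    IsSimpleIsolatedEigenvalue T l ↔ IsSimpleIsolatedEigenvalue T' l := by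
  rw [IsSimpleIsolatedEigenvalue, IsSimpleIsolatedEigenvalue, spec_eq_of_equiv U hU,
    finrank_eigenspace_eq_of_equiv U hU]

end UnitaryEquivalence

/-! ### The Dirichlet Laplacian: Green's identity and resolvent -/

section TestFunctions

variable {N : ℕ} {a : ℝ} {U : Set (Config N)} {φ χ : Config N → ℂ}

theorem IsTest.conj (h : IsTest U φ) : IsTest U (fun x => starRingEnd ℂ (φ x)) := by
  refine ⟨Complex.conjCLE.contDiff.comp h.1, h.2.1.comp_left (g := starRingEnd ℂ) (map_zero _), ?_⟩
  exact (tsupport_comp_subset (g := starRingEnd ℂ) (map_zero _) φ).trans h.2.2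

theorem IsTest.pd_conj (h : IsTest U φ) (i : Fin N) (k : Fin 3) :
    AtomLayer.pd i k (fun x => starRingEnd ℂ (φ x))
      = fun x => starRingEnd ℂ (AtomLayer.pd i k φ x) := by
  ext x
  have h1 : HasFDerivAt (fun x => starRingEnd ℂ (φ x))
      ((Complex.conjCLE : ℂ →L[ℝ] ℂ) ∘L fderiv ℝ φ x) x :=
    (Complex.conjCLE : ℂ →L[ℝ] ℂ).hasFDerivAt.comp x (h.differentiable x).hasFDerivAt
  rw [AtomLayer.pd, h1.fderiv]
  rfl

theorem IsTest.lap_conj (h : IsTest U φ) :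
    AtomLayer.lap (fun x => starRingEnd ℂ (φ x)) = fun x => starRingEnd ℂ (AtomLayer.lap φ x) := by
  ext x
  simp only [AtomLayer.lap, h.pd_conj, (h.pd _ _).pd_conj, map_sum]

theorem IsTest.eq_zero_of_notMem (h : IsTest U φ) {x : Config N} (hx : x ∉ U) : φ x = 0 :=
  image_eq_zero_of_notMem_tsupport fun h' => hx (h.2.2 h')

/-- The class of a test function in `L²`. -/
def IsTest.toL2 (h : IsTest U φ) (a : ℝ) : L2 N a := (h.memLp (layerMeasure N a)).toLp φ

theorem IsTest.coeFn_toL2 (h : IsTest U φ) : h.toL2 a =ᵐ[layerMeasure N a] φ := MemLp.coeFn_toLp _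

theorem IsTest.inner_toL2 (h : IsTest U φ) (u : L2 N a) :
    inner ℂ (h.toL2 a) u = ∫ x, u x * starRingEnd ℂ (φ x) ∂(layerMeasure N a) := by
  rw [L2.inner_def]
  refine integral_congr_ae ?_
  filter_upwards [h.coeFn_toL2 (a := a)] with x hx
  rw [hx]
  simp

theorem IsTest.integral_mul_pd (h : IsTest U φ) (h' : IsTest U χ) (i : Fin N) (k : Fin 3) :
    ∫ x, φ x * AtomLayer.pd i k χ x = -∫ x, AtomLayer.pd i k φ x * χ x := by
  have hint : ∀ {f g : Config N → ℂ}, IsTest U f → IsTest U g →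
      Integrable (fun x => f x * g x) := fun hf hg =>
    (hf.1.continuous.mul hg.1.continuous).integrable_of_hasCompactSupport hf.2.1.mul_right
  exact integral_mul_fderiv_eq_neg_fderiv_mul_of_integrable (𝕜 := ℂ) (μ := volume) (hint (h.pd i k) h')
    (hint h (h'.pd i k)) (hint h h') (fun x _ => h.differentiable x)
    (fun x _ => h'.differentiable x)

/-- Test functions vanish off the layer, so integration by parts can be done on the whole
configuration space without boundary terms. -/
theorem IsTest.inner_toL2_toL2 (h : IsTest (layerPow N a) φ) (h' : IsTest (layerPow N a) χ) :
    inner ℂ (h.toL2 a) (h'.toL2 a) = ∫ x, χ x * starRingEnd ℂ (φ x) := by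
  have e : ∫ x, χ x * starRingEnd ℂ (φ x) ∂(layerMeasure N a)
      = ∫ x, χ x * starRingEnd ℂ (φ x) :=
    setIntegral_eq_integral_of_forall_compl_eq_zero fun x hx => by
      rw [h'.eq_zero_of_notMem hx, zero_mul]
  rw [h.inner_toL2, ← e]
  refine integral_congr_ae ?_
  filter_upwards [h'.coeFn_toL2 (a := a)] with x hx
  rw [hx]

theorem IsTest.inner_pd_pd (h : IsTest (layerPow N a) φ) (h' : IsTest (layerPow N a) χ)
    (i : Fin N) (k : Fin 3) :
    inner ℂ (((h.pd i k).pd i k).toL2 a) (h'.toL2 a)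
      = -inner ℂ ((h.pd i k).toL2 a) ((h'.pd i k).toL2 a) := by
  rw [inner_toL2_toL2, inner_toL2_toL2]
  simp only [← congrFun ((h.pd i k).pd_conj i k)]
  exact h'.integral_mul_pd (h.pd i k).conj i k

theorem IsTest.toL2_lap (h : IsTest U φ) :
    h.lap.toL2 a = ∑ i, ∑ k, ((h.pd i k).pd i k).toL2 a := by
  refine Lp.ext (h.lap.coeFn_toL2.trans ?_)
  have h1 : ∀ᵐ x ∂(layerMeasure N a), ∀ i k, ((h.pd i k).pd i k).toL2 a x
      = AtomLayer.pd i k (AtomLayer.pd i k φ) x := by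
    rw [ae_all_iff]; intro i
    rw [ae_all_iff]; intro k
    exact ((h.pd i k).pd i k).coeFn_toL2
  have h2 : ∀ᵐ x ∂(layerMeasure N a), ∀ i, (∑ k, ((h.pd i k).pd i k).toL2 a : L2 N a) x
      = ∑ k, ((h.pd i k).pd i k).toL2 a x := by
    rw [ae_all_iff]; intro i
    filter_upwards [Lp.coeFn_finsetSum Finset.univ fun k => ((h.pd i k).pd i k).toL2 a] with x hx
    rw [hx, Finset.sum_apply]
  filter_upwards [h1, h2, Lp.coeFn_finsetSum Finset.univ
    fun i => (∑ k, ((h.pd i k).pd i k).toL2 a : L2 N a)] with x hx1 hx2 hx3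
  rw [hx3, Finset.sum_apply]
  simp only [hx2, hx1, AtomLayer.lap]

/-- The `L²` classes of `φ` and of its partial derivatives. -/
def IsTest.toGraph (h : IsTest (layerPow N a) φ) : L2 N a × (Fin N → Fin 3 → L2 N a) :=
  (h.toL2 a, fun i k => (h.pd i k).toL2 a)

theorem mem_testGraph_iff {p : L2 N a × (Fin N → Fin 3 → L2 N a)} :
    p ∈ testGraph N a ↔ ∃ φ, ∃ h : IsTest (layerPow N a) φ, p = h.toGraph := by
  constructor
  · rintro ⟨φ, h, h1, h2⟩
    refine ⟨φ, h, Prod.ext (Lp.ext (h1.trans h.coeFn_toL2.symm)) ?_⟩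
    funext i k
    exact Lp.ext ((h2 i k).trans (h.pd i k).coeFn_toL2.symm)
  · rintro ⟨φ, h, rfl⟩
    exact ⟨φ, h, h.coeFn_toL2, fun i k => (h.pd i k).coeFn_toL2⟩

theorem IsTest.toGraph_mem (h : IsTest (layerPow N a) φ) :
    h.toGraph ∈ (testGraph N a).topologicalClosure :=
  Submodule.le_topologicalClosure _ (mem_testGraph_iff.2 ⟨φ, h, rfl⟩)

end TestFunctions

section Laplacian

variable {N : ℕ} {a : ℝ}

/-- Density principle: a closed condition on a function and its gradient need only be checked on
test functions. -/
theorem closure_testGraph_induction {P : L2 N a × (Fin N → Fin 3 → L2 N a) → Prop}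
    (hP : IsClosed {p | P p})
    (h : ∀ (φ : Config N → ℂ) (hφ : IsTest (layerPow N a) φ), P hφ.toGraph)
    {p : L2 N a × (Fin N → Fin 3 → L2 N a)} (hp : p ∈ (testGraph N a).topologicalClosure) : P p := by
  refine closure_minimal (s := (testGraph N a : Set (L2 N a × (Fin N → Fin 3 → L2 N a))))
    (t := {p | P p}) ?_ hP hp
  intro q hq
  obtain ⟨φ, hφ, rfl⟩ := mem_testGraph_iff.1 hq
  exact h φ hφ

theorem inner_lap_eq {u : L2 N a} {v : Fin N → Fin 3 → L2 N a}
    (h : (u, v) ∈ (testGraph N a).topologicalClosure) {φ : Config N → ℂ}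
    (hφ : IsTest (layerPow N a) φ) :
    inner ℂ (hφ.lap.toL2 a) u = -∑ i, ∑ k, inner ℂ ((hφ.pd i k).toL2 a) (v i k) := by
  refine closure_testGraph_induction (P := fun p => inner ℂ (hφ.lap.toL2 a) p.1
    = -∑ i, ∑ k, inner ℂ ((hφ.pd i k).toL2 a) (p.2 i k)) ?_ ?_ h
  · exact isClosed_eq (by fun_prop) (by fun_prop)
  · intro χ hχ
    simp only [IsTest.toGraph, hφ.toL2_lap, sum_inner, hφ.inner_pd_pd hχ, Finset.sum_neg_distrib]

/-- Replacing `φ` by its conjugate turns the bilinear distributional pairing into inner products. -/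
theorem mem_dirichletGraph_iff {u f : L2 N a} :
    (u, f) ∈ dirichletGraph N a ↔ u ∈ H10 N a ∧ ∀ φ (hφ : IsTest (layerPow N a) φ),
      inner ℂ (hφ.toL2 a) f = -inner ℂ (hφ.lap.toL2 a) u := by
  refine and_congr_right fun _ => ⟨fun h φ hφ => ?_, fun h φ hφ => ?_⟩
  · rw [hφ.inner_toL2, hφ.lap.inner_toL2]
    simp only [← congrFun hφ.lap_conj]
    exact h _ hφ.conj
  · have := h _ hφ.conj
    rw [hφ.conj.inner_toL2, hφ.conj.lap.inner_toL2, hφ.lap_conj] at this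
    simpa only [Complex.conj_conj] using this

theorem mem_H10_iff {u : L2 N a} :
    u ∈ H10 N a ↔ ∃ v, (u, v) ∈ (testGraph N a).topologicalClosure := by
  rw [H10, Submodule.mem_map]
  constructor
  · rintro ⟨⟨u, v⟩, h, rfl⟩
    exact ⟨v, h⟩
  · rintro ⟨v, h⟩
    exact ⟨(u, v), h, rfl⟩

/-- Green's identity. -/
theorem inner_eq_of_mem_dirichletGraph {u f w : L2 N a} {v w' : Fin N → Fin 3 → L2 N a}
    (h : (u, f) ∈ dirichletGraph N a) (hv : (u, v) ∈ (testGraph N a).topologicalClosure)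
    (hw : (w, w') ∈ (testGraph N a).topologicalClosure) :
    inner ℂ w f = ∑ i, ∑ k, inner ℂ (w' i k) (v i k) := by
  refine closure_testGraph_induction (P := fun p => inner ℂ p.1 f
    = ∑ i, ∑ k, inner ℂ (p.2 i k) (v i k)) ?_ ?_ hw
  · exact isClosed_eq (by fun_prop) (by fun_prop)
  · intro φ hφ
    have := (mem_dirichletGraph_iff.1 h).2 φ hφ
    rw [inner_lap_eq hv hφ, neg_neg] at this
    exact this

theorem mem_dirichletGraph_of_weak {u f : L2 N a} {v : Fin N → Fin 3 → L2 N a}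
    (hv : (u, v) ∈ (testGraph N a).topologicalClosure)
    (h : ∀ φ (hφ : IsTest (layerPow N a) φ),
      inner ℂ (hφ.toL2 a) f = ∑ i, ∑ k, inner ℂ ((hφ.pd i k).toL2 a) (v i k)) :
    (u, f) ∈ dirichletGraph N a := by
  refine mem_dirichletGraph_iff.2 ⟨mem_H10_iff.2 ⟨v, hv⟩, fun φ hφ => ?_⟩
  rw [inner_lap_eq hv hφ, neg_neg]
  exact h φ hφ

theorem dirichletGraph_symmetric {u f u' f' : L2 N a} (h : (u, f) ∈ dirichletGraph N a)
    (h' : (u', f') ∈ dirichletGraph N a) : inner ℂ f u' = inner ℂ u f' := by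
  obtain ⟨v, hv⟩ := mem_H10_iff.1 (mem_dirichletGraph_iff.1 h).1
  obtain ⟨v', hv'⟩ := mem_H10_iff.1 (mem_dirichletGraph_iff.1 h').1
  rw [← inner_conj_symm, inner_eq_of_mem_dirichletGraph h hv hv',
    inner_eq_of_mem_dirichletGraph h' hv' hv]
  simp only [map_sum, inner_conj_symm]

/-- Energy identity for `(-Δ + s)u = f`: Green's identity tested with `u` itself. -/
theorem sum_norm_sq_add_eq {u f : L2 N a} {v : Fin N → Fin 3 → L2 N a} {s : ℝ}
    (h : (u, f - (s : ℂ) • u) ∈ dirichletGraph N a)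
    (hv : (u, v) ∈ (testGraph N a).topologicalClosure) :
    ∑ i, ∑ k, ‖v i k‖ ^ 2 + s * ‖u‖ ^ 2 = (inner ℂ u f).re := by
  have := congrArg Complex.re (inner_eq_of_mem_dirichletGraph h hv hv)
  simp only [inner_sub_right, inner_smul_right, inner_self_eq_norm_sq_to_K] at this
  have h2 : (∑ i, ∑ k, (‖v i k‖ : ℂ) ^ 2).re = ∑ i, ∑ k, ‖v i k‖ ^ 2 := by
    norm_cast
  have h3 : ((s : ℂ) * (‖u‖ : ℂ) ^ 2).re = s * ‖u‖ ^ 2 := by norm_cast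
  have e : ((inner ℂ u f).re - s * ‖u‖ ^ 2) = ∑ i, ∑ k, ‖v i k‖ ^ 2 := by
    rw [← h2, ← h3, ← Complex.sub_re]
    exact this
  linarith

theorem norm_le_of_mem_dirichletGraph {u f : L2 N a} {s : ℝ} (hs : 0 < s)
    (h : (u, f - (s : ℂ) • u) ∈ dirichletGraph N a) : ‖u‖ ≤ s⁻¹ * ‖f‖ := by
  obtain ⟨v, hv⟩ := mem_H10_iff.1 (mem_dirichletGraph_iff.1 h).1
  have h1 := sum_norm_sq_add_eq h hv
  have h2 : (inner ℂ u f).re ≤ ‖u‖ * ‖f‖ := (Complex.re_le_norm _).trans (norm_inner_le_norm _ _)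
  have h3 : 0 ≤ ∑ i, ∑ k, ‖v i k‖ ^ 2 := by positivity
  rw [inv_mul_eq_div, le_div_iff₀ hs]
  by_contra! h4
  have hu : 0 < ‖u‖ := by
    by_contra h5
    have : ‖u‖ = 0 := le_antisymm (not_lt.1 h5) (norm_nonneg _)
    rw [this, zero_mul] at h4
    exact absurd (norm_nonneg f) (not_le.2 h4)
  nlinarith

/-- The energy is at most `‖u‖‖f‖ ≤ s⁻¹‖f‖²`. This is the source of the decay `s^{-1/2}` of `∇(-Δ +
s)⁻¹`. -/
theorem sum_norm_sq_le {u f : L2 N a} {v : Fin N → Fin 3 → L2 N a} {s : ℝ} (hs : 0 < s)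
    (h : (u, f - (s : ℂ) • u) ∈ dirichletGraph N a)
    (hv : (u, v) ∈ (testGraph N a).topologicalClosure) :
    ∑ i, ∑ k, ‖v i k‖ ^ 2 ≤ s⁻¹ * ‖f‖ ^ 2 := by
  have h1 := sum_norm_sq_add_eq h hv
  have h2 : (inner ℂ u f).re ≤ ‖u‖ * ‖f‖ := (Complex.re_le_norm _).trans (norm_inner_le_norm _ _)
  have h3 : 0 ≤ s * ‖u‖ ^ 2 := by positivity
  have h4 := mul_le_mul_of_nonneg_right (norm_le_of_mem_dirichletGraph hs h) (norm_nonneg f)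
  nlinarith

/-- `L² × (L²)^{3N}` as a Hilbert space. -/
abbrev GradSpace (N : ℕ) (a : ℝ) : Type :=
  WithLp 2 (L2 N a × PiLp 2 fun _ : Fin N × Fin 3 => L2 N a)

/-- `(u, v) ↦ (t u, v)` from `GradSpace`. -/
def gradSpaceMap (N : ℕ) (a t : ℝ) :
    GradSpace N a →ₗ[ℂ] L2 N a × (Fin N → Fin 3 → L2 N a) where
  toFun e := ((t : ℂ) • e.fst, fun i k => e.snd (i, k))
  map_add' e e' := by ext1 <;> simp [smul_add]; rfl
  map_smul' c e := by ext1 <;> simp [smul_comm]; rfl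

theorem continuous_gradSpaceMap (N : ℕ) (a t : ℝ) : Continuous (gradSpaceMap N a t) := by
  refine Continuous.prodMk ?_ ?_
  · fun_prop
  · fun_prop

/-- Lax–Milgram by orthogonal projection. With `t = s^{-1/2}`, the pairs `(t⁻¹u, ∇u)` form a closed
subspace `G` with norm squared `s‖u‖² + ‖∇u‖²`. Projecting `(t f, 0)` onto `G` yields the weak
solution of `(-Δ + s)u = f`, and linearity and continuity in `f` come with the projection. -/
theorem exists_weak_solution {s : ℝ} (hs : 0 < s) :
    ∃ R : L2 N a →L[ℂ] L2 N a, ∀ f, (R f, f - (s : ℂ) • R f) ∈ dirichletGraph N a := by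
  obtain ⟨t, ht, hts⟩ : ∃ t : ℝ, 0 < t ∧ (s : ℂ) * t * t = 1 := by
    refine ⟨(Real.sqrt s)⁻¹, inv_pos.2 (Real.sqrt_pos.2 hs), ?_⟩
    have : s * (Real.sqrt s)⁻¹ * (Real.sqrt s)⁻¹ = 1 := by
      rw [mul_assoc, ← mul_inv, Real.mul_self_sqrt hs.le, mul_inv_cancel₀ hs.ne']
    exact_mod_cast this
  set G : Submodule ℂ (GradSpace N a) :=
    (testGraph N a).topologicalClosure.comap (gradSpaceMap N a t)
  have hG : IsClosed (G : Set (GradSpace N a)) :=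
    (testGraph N a).isClosed_topologicalClosure.preimage (continuous_gradSpaceMap N a t)
  have : CompleteSpace G := hG.completeSpace_coe
  let J : L2 N a →L[ℂ] GradSpace N a :=
    ((WithLp.prodContinuousLinearEquiv 2 ℂ (L2 N a) (PiLp 2 fun _ : Fin N × Fin 3 => L2 N a)).symm :
      (L2 N a × PiLp 2 fun _ : Fin N × Fin 3 => L2 N a) →L[ℂ] GradSpace N a) ∘L ContinuousLinearMap.inl ℂ _ _
  let F : GradSpace N a →L[ℂ] L2 N a := ContinuousLinearMap.fst ℂ _ _ ∘L
    ((WithLp.prodContinuousLinearEquiv 2 ℂ (L2 N a) (PiLp 2 fun _ : Fin N × Fin 3 => L2 N a)) :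
      GradSpace N a →L[ℂ] (L2 N a × PiLp 2 fun _ : Fin N × Fin 3 => L2 N a))
  refine ⟨((t : ℂ) * t) • (F ∘L G.starProjection ∘L J), fun f => ?_⟩
  set e := G.starProjection ((t : ℂ) • J f) with e_def
  have heR : (((t : ℂ) * t) • (F ∘L G.starProjection ∘L J)) f = (t : ℂ) • e.fst := by
    rw [e_def, map_smul]
    change ((t : ℂ) * t) • F (G.starProjection (J f)) = (t : ℂ) • F ((t : ℂ) • _)
    rw [map_smul, smul_smul]
  have heG : e ∈ G := Submodule.starProjection_apply_mem _ _
  rw [heR]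
  refine mem_dirichletGraph_of_weak (v := fun i k => e.snd (i, k)) heG fun φ hφ => ?_
  have horth := Submodule.sub_starProjection_mem_orthogonal (K := G) ((t : ℂ) • J f)
  set g : GradSpace N a := WithLp.toLp 2 (((t⁻¹ : ℝ) : ℂ) • hφ.toL2 a,
    WithLp.toLp 2 fun p : Fin N × Fin 3 => (hφ.pd p.1 p.2).toL2 a) with g_def
  have hgG : gradSpaceMap N a t g ∈ (testGraph N a).topologicalClosure := by
    have : gradSpaceMap N a t g = hφ.toGraph := by
      refine Prod.ext ?_ rfl
      change (t : ℂ) • ((t⁻¹ : ℝ) : ℂ) • hφ.toL2 a = hφ.toL2 a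
      rw [smul_smul, ← Complex.ofReal_mul, mul_inv_cancel₀ ht.ne', Complex.ofReal_one, one_smul]
    rw [this]
    exact hφ.toGraph_mem
  have h1 := (Submodule.mem_orthogonal _ _).1 horth g hgG
  have hst : (s : ℂ) * t = ((t⁻¹ : ℝ) : ℂ) := by
    rw [Complex.ofReal_inv]
    exact eq_inv_of_mul_eq_one_left hts
  have htt : (t : ℂ) * ((t⁻¹ : ℝ) : ℂ) = 1 := by
    rw [← Complex.ofReal_mul, mul_inv_cancel₀ ht.ne', Complex.ofReal_one]
  have h2 : inner ℂ g (J f) = ((t⁻¹ : ℝ) : ℂ) * inner ℂ (hφ.toL2 a) f := by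
    rw [WithLp.prod_inner_apply]
    have h3 : (J f).ofLp.2 = 0 := rfl
    have h4 : (J f).ofLp.1 = f := rfl
    rw [h3, h4, inner_zero_right, add_zero, g_def, inner_smul_left, Complex.conj_ofReal]
  have h5 : inner ℂ g e = ((t⁻¹ : ℝ) : ℂ) * inner ℂ (hφ.toL2 a) e.fst
      + ∑ i, ∑ k, inner ℂ ((hφ.pd i k).toL2 a) (e.snd (i, k)) := by
    rw [WithLp.prod_inner_apply, PiLp.inner_apply, Fintype.sum_prod_type, g_def, inner_smul_left,
      Complex.conj_ofReal]
    rfl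
  rw [← e_def, inner_sub_right, inner_smul_right, h2, h5, ← mul_assoc, htt] at h1
  rw [inner_sub_right, smul_smul, inner_smul_right, hst]
  linear_combination h1

end Laplacian

/-! ### Hardy's inequality -/

section Hardy

variable {N : ℕ} {U : Set (Config N)} {φ : Config N → ℂ}

/-- The unit vector of the `k`-th coordinate of the `i`-th particle. -/
abbrev coordVec (i : Fin N) (k : Fin 3) : Config N := Pi.single i (EuclideanSpace.single k (1 : ℝ))

/-- The components of the field `Lx / (|Lx|² + ε)` that drives Hardy's inequality. The hypothesis on
`L` lets `r_i` and `r_i - r_j` be treated together: both move with the `i`-th particle. -/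
theorem hasLineDerivAt_hardyField {L : Config N →L[ℝ] EuclideanSpace ℝ (Fin 3)} {i : Fin N}
    (hL : ∀ v, L (Pi.single i v) = v) {ε : ℝ} (hε : 0 < ε) (k : Fin 3) (x : Config N) :
    HasLineDerivAt ℝ (fun x => L x k * (‖L x‖ ^ 2 + ε)⁻¹)
      ((‖L x‖ ^ 2 + ε)⁻¹ - 2 * (L x k) ^ 2 * ((‖L x‖ ^ 2 + ε)⁻¹) ^ 2) x (coordVec i k) := by
  have hpos : 0 < ‖L x‖ ^ 2 + ε := by positivity
  have e : (fun t : ℝ => L (x + t • coordVec i k) k * (‖L (x + t • coordVec i k)‖ ^ 2 + ε)⁻¹)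
      = fun t => (L x k + t) * (‖L x‖ ^ 2 + 2 * t * L x k + t ^ 2 + ε)⁻¹ := by
    funext t
    have h1 : (L x + t • EuclideanSpace.single k (1 : ℝ)) k = L x k + t := by simp
    have h2 : ‖L x + t • EuclideanSpace.single k (1 : ℝ)‖ ^ 2
        = ‖L x‖ ^ 2 + 2 * t * L x k + t ^ 2 := by
      rw [norm_add_sq_real, inner_smul_right, EuclideanSpace.inner_single_right, norm_smul,
        PiLp.norm_single, Real.norm_eq_abs, norm_one, mul_one, sq_abs]
      simp [mul_assoc]
    rw [map_add, map_smul, hL, h1, h2]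
  rw [HasLineDerivAt, e]
  have h1 : HasDerivAt (fun t : ℝ => L x k + t) 1 0 := (hasDerivAt_id 0).const_add _
  have h2 : HasDerivAt (fun t : ℝ => ‖L x‖ ^ 2 + 2 * t * L x k + t ^ 2 + ε) (2 * L x k) 0 := by
    have h3 : HasDerivAt (fun t : ℝ => 2 * t * L x k) (2 * L x k) 0 := by
      simpa using ((hasDerivAt_id (0 : ℝ)).const_mul 2).mul_const (L x k)
    have h4 : HasDerivAt (fun t : ℝ => t ^ 2) 0 0 := by simpa using hasDerivAt_pow 2 (0 : ℝ)
    simpa using ((h3.const_add (‖L x‖ ^ 2)).add h4).add_const ε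
  have h5 := h1.mul (h2.fun_inv (by simpa using hpos.ne'))
  refine h5.congr_deriv ?_
  simp only [mul_zero, zero_mul, add_zero, ne_eq, OfNat.ofNat_ne_zero, not_false_eq_true, zero_pow,
    one_mul]
  field_simp
  ring

theorem IsTest.hasLineDerivAt_norm_sq (h : IsTest U φ) (i : Fin N) (k : Fin 3) (x : Config N) :
    HasLineDerivAt ℝ (fun x => ‖φ x‖ ^ 2) (2 * inner ℝ (φ x) (AtomLayer.pd i k φ x)) x
      (coordVec i k) := by
  have h1 : HasDerivAt (fun t : ℝ => φ (x + t • coordVec i k)) (AtomLayer.pd i k φ x) 0 :=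
    (h.differentiable x).hasFDerivAt.hasLineDerivAt (coordVec i k)
  have := h1.norm_sq
  simpa [HasLineDerivAt] using this

theorem IsTest.integrable_mul_norm_sq (h : IsTest U φ) {g : Config N → ℝ} (hg : Continuous g) :
    Integrable fun x => g x * ‖φ x‖ ^ 2 := by
  have hc : Continuous fun x => g x * ‖φ x‖ ^ 2 := hg.mul (h.1.continuous.norm.pow 2)
  refine hc.integrable_of_hasCompactSupport (HasCompactSupport.intro h.2.1 fun x hx => ?_)
  rw [image_eq_zero_of_notMem_tsupport hx, norm_zero, zero_pow two_ne_zero, mul_zero]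

theorem IsTest.integrable_norm_sq (h : IsTest U φ) : Integrable fun x => ‖φ x‖ ^ 2 := by
  have := h.integrable_mul_norm_sq (g := fun _ => 1) continuous_const
  simpa only [one_mul] using this

/-- Hardy's inequality with a regularized weight. -/
theorem IsTest.hardy_regularized (h : IsTest U φ) {L : Config N →L[ℝ] EuclideanSpace ℝ (Fin 3)}
    {i : Fin N} (hL : ∀ v, L (Pi.single i v) = v) {ε : ℝ} (hε : 0 < ε) :
    ∫ x, (‖L x‖ ^ 2 + ε)⁻¹ * ‖φ x‖ ^ 2 ≤ 4 * ∑ k, ∫ x, ‖AtomLayer.pd i k φ x‖ ^ 2 := by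
  have hpos : ∀ x, 0 < ‖L x‖ ^ 2 + ε := fun x => by positivity
  set w : Config N → ℝ := fun x => (‖L x‖ ^ 2 + ε)⁻¹ with w_def
  have hwc : Continuous w := Continuous.inv₀ (by fun_prop) fun x => (hpos x).ne'
  have hLc : ∀ k, Continuous fun x => L x k := fun k => by fun_prop
  have hw0 : ∀ x, 0 ≤ w x := fun x => (inv_pos.2 (hpos x)).le
  have hw1 : ∀ x, ‖L x‖ ^ 2 * w x ≤ 1 := fun x => by
    rw [w_def]
    simp only
    rw [← div_eq_mul_inv, div_le_one (hpos x)]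
    linarith
  have hsq : ∀ x, ∑ k, (L x k) ^ 2 = ‖L x‖ ^ 2 := fun x => by
    rw [EuclideanSpace.norm_sq_eq]
    simp
  set D : Fin 3 → Config N → ℝ := fun k x => w x - 2 * (L x k) ^ 2 * (w x) ^ 2 with D_def
  have hDc : ∀ k, Continuous (D k) := fun k =>
    hwc.sub ((continuous_const.mul ((hLc k).pow 2)).mul (hwc.pow 2))
  set ρ' : Fin 3 → Config N → ℝ := fun k x => 2 * inner ℝ (φ x) (AtomLayer.pd i k φ x) with ρ'_def
  have hρ'c : ∀ k, Continuous (ρ' k) := fun k =>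
    continuous_const.mul (h.1.continuous.inner (h.pd i k).1.continuous)
  have hρ's : ∀ k, HasCompactSupport (ρ' k) := fun k => by
    refine HasCompactSupport.intro h.2.1 fun x hx => ?_
    simp [ρ'_def, image_eq_zero_of_notMem_tsupport hx]
  have hFρ' : ∀ k, Integrable fun x => (L x k * w x) * ρ' k x := fun k =>
    (((hLc k).mul hwc).mul (hρ'c k)).integrable_of_hasCompactSupport (hρ's k).mul_left
  have hDρ : ∀ k, Integrable fun x => D k x * ‖φ x‖ ^ 2 := fun k =>
    h.integrable_mul_norm_sq (hDc k)
  have hibp : ∀ k, ∫ x, (L x k * w x) * ρ' k x = -∫ x, D k x * ‖φ x‖ ^ 2 := fun k =>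
    integral_bilinear_hasLineDerivAt_right_eq_neg_left_of_integrable (μ := volume)
      (B := ContinuousLinearMap.mul ℝ ℝ) (v := coordVec i k)
      (f := fun x => L x k * w x) (f' := D k) (g := fun x => ‖φ x‖ ^ 2) (g' := ρ' k)
      (hDρ k) (hFρ' k) (h.integrable_mul_norm_sq ((hLc k).mul hwc))
      (fun x _ => hasLineDerivAt_hardyField hL hε k x)
      (fun x _ => h.hasLineDerivAt_norm_sq i k x)
  have hwρ : Integrable fun x => w x * ‖φ x‖ ^ 2 := h.integrable_mul_norm_sq hwc
  have hpd : ∀ k, Integrable fun x => ‖AtomLayer.pd i k φ x‖ ^ 2 := fun k =>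
    (h.pd i k).integrable_norm_sq
  -- The bracket is the divergence of the field times `|φ|²`, so its integral vanishes by `hibp`.
  -- Its field part gives `3w - 2|L|²w²`, Young's inequality costs `½|L|²w²`, and `|L|²w ≤ 1` leaves
  -- `3 - 2 - ½ = ½`; the `3` is the space dimension.
  have hpt : ∀ x, (1 / 2) * (w x * ‖φ x‖ ^ 2) ≤
      (∑ k, (D k x * ‖φ x‖ ^ 2 + (L x k * w x) * ρ' k x))
        + 2 * ∑ k, ‖AtomLayer.pd i k φ x‖ ^ 2 := by
    intro x
    have h1 : ∀ k, -(2 * ‖AtomLayer.pd i k φ x‖ ^ 2 + (1 / 2) * ((L x k) ^ 2 * (w x) ^ 2 * ‖φ x‖ ^ 2))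
        ≤ (L x k * w x) * ρ' k x := fun k => by
      have h2 : |inner ℝ (φ x) (AtomLayer.pd i k φ x)| ≤ ‖φ x‖ * ‖AtomLayer.pd i k φ x‖ :=
        abs_real_inner_le_norm _ _
      have h3 : |(L x k * w x) * ρ' k x|
          ≤ 2 * (|L x k * w x| * ‖φ x‖) * ‖AtomLayer.pd i k φ x‖ := by
        rw [ρ'_def]
        simp only
        rw [abs_mul, abs_mul 2, abs_two]
        have := mul_le_mul_of_nonneg_left h2 (abs_nonneg (L x k * w x))
        linarith
      have h4 : (|L x k * w x| * ‖φ x‖) ^ 2 = (L x k) ^ 2 * (w x) ^ 2 * ‖φ x‖ ^ 2 := by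
        rw [mul_pow, sq_abs, mul_pow]
      rw [← h4]
      have h5 := (abs_le.1 h3).1
      nlinarith [sq_nonneg (|L x k * w x| * ‖φ x‖ - 2 * ‖AtomLayer.pd i k φ x‖)]
    have h6 := Finset.sum_le_sum fun (k : Fin 3) (_ : k ∈ Finset.univ) => h1 k
    have h7 : ∑ k, D k x * ‖φ x‖ ^ 2 = 3 * (w x * ‖φ x‖ ^ 2)
        - 2 * (‖L x‖ ^ 2 * (w x) ^ 2 * ‖φ x‖ ^ 2) := by
      rw [← hsq]
      simp only [D_def, Fin.sum_univ_three]
      ring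
    have h8 : ∑ k, -(2 * ‖AtomLayer.pd i k φ x‖ ^ 2
          + (1 / 2) * ((L x k) ^ 2 * (w x) ^ 2 * ‖φ x‖ ^ 2))
        = -(2 * ∑ k, ‖AtomLayer.pd i k φ x‖ ^ 2)
          - (1 / 2) * (‖L x‖ ^ 2 * (w x) ^ 2 * ‖φ x‖ ^ 2) := by
      rw [← hsq]
      simp only [Fin.sum_univ_three]
      ring
    have h9 : ‖L x‖ ^ 2 * (w x) ^ 2 * ‖φ x‖ ^ 2 ≤ w x * ‖φ x‖ ^ 2 := by
      have := mul_le_mul_of_nonneg_right (hw1 x) (mul_nonneg (hw0 x) (sq_nonneg ‖φ x‖))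
      linarith
    rw [Finset.sum_add_distrib, h7]
    rw [h8] at h6
    linarith
  have hsum : ∀ k, Integrable fun x => D k x * ‖φ x‖ ^ 2 + (L x k * w x) * ρ' k x := fun k =>
    (hDρ k).add (hFρ' k)
  have hS1 : Integrable fun x => ∑ k, (D k x * ‖φ x‖ ^ 2 + (L x k * w x) * ρ' k x) :=
    integrable_finsetSum Finset.univ fun k _ => hsum k
  have hS2 : Integrable fun x => 2 * ∑ k, ‖AtomLayer.pd i k φ x‖ ^ 2 :=
    (integrable_finsetSum Finset.univ fun k _ => hpd k).const_mul 2
  have hint := integral_mono (hwρ.const_mul (1 / 2)) (hS1.add hS2) hpt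
  have hI1 : ∫ x, ∑ k, (D k x * ‖φ x‖ ^ 2 + (L x k * w x) * ρ' k x) = 0 := by
    rw [integral_finsetSum Finset.univ fun k _ => hsum k]
    refine Finset.sum_eq_zero fun k _ => ?_
    rw [integral_add (hDρ k) (hFρ' k), hibp k, add_neg_cancel]
  have hI2 : ∫ x, 2 * ∑ k, ‖AtomLayer.pd i k φ x‖ ^ 2
      = 2 * ∑ k, ∫ x, ‖AtomLayer.pd i k φ x‖ ^ 2 := by
    rw [integral_const_mul, integral_finsetSum Finset.univ fun k _ => hpd k]
  have hI3 : ∫ x, ((∑ k, (D k x * ‖φ x‖ ^ 2 + (L x k * w x) * ρ' k x))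
      + 2 * ∑ k, ‖AtomLayer.pd i k φ x‖ ^ 2) = 2 * ∑ k, ∫ x, ‖AtomLayer.pd i k φ x‖ ^ 2 := by
    rw [integral_add hS1 hS2, hI1, hI2, zero_add]
  have hint' : (1 / 2) * ∫ x, w x * ‖φ x‖ ^ 2 ≤ 2 * ∑ k, ∫ x, ‖AtomLayer.pd i k φ x‖ ^ 2 := by
    rw [← hI3, ← integral_const_mul]
    exact hint
  linarith

end Hardy

/-! ### Relative boundedness of the Coulomb potential -/

section GradBounded

variable {N : ℕ} {a : ℝ}

theorem eLpNorm_two_le {X : Type*} [MeasurableSpace X] {μ : Measure X} {f : X → ℂ} {ρ : X → ℝ}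
    (hρ : Integrable ρ μ) (h : ∀ x, ‖f x‖ ^ 2 ≤ ρ x) {C : ℝ} (hC : 0 ≤ C)
    (hint : ∫ x, ρ x ∂μ ≤ C ^ 2) : eLpNorm f 2 μ ≤ ENNReal.ofReal C := by
  have h1 : eLpNorm f 2 μ ^ (2 : ℝ) ≤ ENNReal.ofReal C ^ (2 : ℝ) := by
    have h2 := eLpNorm_nnreal_pow_eq_lintegral (f := f) (μ := μ) (p := 2) (by norm_num)
    simp only [NNReal.coe_ofNat, ENNReal.coe_ofNat] at h2
    rw [h2, ENNReal.ofReal_rpow_of_nonneg hC (by norm_num), Real.rpow_two]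
    refine le_trans (lintegral_mono fun x => ?_) ((ofReal_integral_eq_lintegral_ofReal hρ
      (ae_of_all _ fun x => (sq_nonneg _).trans (h x))).symm.le.trans (ENNReal.ofReal_le_ofReal hint))
    rw [← ofReal_norm, ENNReal.ofReal_rpow_of_nonneg (norm_nonneg _) (by norm_num),
      Real.rpow_two]
    exact ENNReal.ofReal_le_ofReal (h x)
  exact (ENNReal.rpow_le_rpow_iff (by norm_num)).1 h1

/-- The `L²` norm of a gradient. -/
def gradNorm (v : Fin N → Fin 3 → L2 N a) : ℝ := Real.sqrt (∑ i, ∑ k, ‖v i k‖ ^ 2)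

theorem gradNorm_nonneg (v : Fin N → Fin 3 → L2 N a) : 0 ≤ gradNorm v := Real.sqrt_nonneg _

theorem continuous_gradNorm : Continuous (gradNorm : (Fin N → Fin 3 → L2 N a) → ℝ) := by
  unfold gradNorm
  fun_prop

/-- Multiplication by `g` is bounded by the gradient on test functions. -/
def IsGradBounded (N : ℕ) (a : ℝ) (g : Config N → ℝ) : Prop :=
  Measurable g ∧ ∃ C, 0 ≤ C ∧ ∀ (φ : Config N → ℂ) (h : IsTest (layerPow N a) φ),
    eLpNorm (fun x => (g x : ℂ) * φ x) 2 (layerMeasure N a)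
      ≤ ENNReal.ofReal (C * gradNorm h.toGraph.2)

theorem IsGradBounded.zero : IsGradBounded N a fun _ => 0 :=
  ⟨measurable_const, 0, le_rfl, fun φ h => by simp⟩

theorem IsGradBounded.add {g g' : Config N → ℝ} (hg : IsGradBounded N a g)
    (hg' : IsGradBounded N a g') : IsGradBounded N a fun x => g x + g' x := by
  obtain ⟨hm, C, hC, h⟩ := hg
  obtain ⟨hm', C', hC', h'⟩ := hg'
  refine ⟨hm.add hm', C + C', add_nonneg hC hC', fun φ hφ => ?_⟩
  have hφm : AEStronglyMeasurable φ (layerMeasure N a) := hφ.1.continuous.aestronglyMeasurable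
  have e : (fun x => ((g x + g' x : ℝ) : ℂ) * φ x)
      = (fun x => (g x : ℂ) * φ x) + fun x => (g' x : ℂ) * φ x := by
    ext x
    simp [add_mul]
  rw [e, add_mul, ENNReal.ofReal_add (mul_nonneg hC (gradNorm_nonneg _))
    (mul_nonneg hC' (gradNorm_nonneg _))]
  refine (eLpNorm_add_le ?_ ?_ (by norm_num)).trans (add_le_add (h φ hφ) (h' φ hφ))
  · exact (Complex.measurable_ofReal.comp hm).aestronglyMeasurable.mul hφm
  · exact (Complex.measurable_ofReal.comp hm').aestronglyMeasurable.mul hφm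

theorem IsGradBounded.const_mul {g : Config N → ℝ} (hg : IsGradBounded N a g) (c : ℝ) :
    IsGradBounded N a fun x => c * g x := by
  obtain ⟨hm, C, hC, h⟩ := hg
  refine ⟨hm.const_mul c, |c| * C, by positivity, fun φ hφ => ?_⟩
  have e : (fun x => ((c * g x : ℝ) : ℂ) * φ x) = (c : ℂ) • fun x => (g x : ℂ) * φ x := by
    ext x
    simp [mul_assoc]
  rw [e, eLpNorm_const_smul, mul_assoc, ENNReal.ofReal_mul (abs_nonneg c)]
  refine mul_le_mul' (le_of_eq ?_) (h φ hφ)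
  rw [← ofReal_norm, Complex.norm_real, Real.norm_eq_abs]

theorem IsGradBounded.sum {ι : Type*} {s : Finset ι} {g : ι → Config N → ℝ}
    (hg : ∀ j ∈ s, IsGradBounded N a (g j)) : IsGradBounded N a fun x => ∑ j ∈ s, g j x := by
  classical
  induction s using Finset.induction_on with
  | empty => simpa using IsGradBounded.zero
  | insert j s hj ih =>
    simp only [Finset.sum_insert hj]
    exact (hg j (Finset.mem_insert_self j s)).add
      (ih fun l hl => hg l (Finset.mem_insert_of_mem hl))

theorem IsTest.norm_sq_toL2 {φ : Config N → ℂ} (h : IsTest (layerPow N a) φ) :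
    ‖h.toL2 a‖ ^ 2 = ∫ x, ‖φ x‖ ^ 2 := by
  have h1 := h.inner_toL2_toL2 h
  rw [inner_self_eq_norm_sq_to_K] at h1
  have h2 : ∫ x, φ x * starRingEnd ℂ (φ x) = ((∫ x, ‖φ x‖ ^ 2 : ℝ) : ℂ) := by
    rw [← integral_complex_ofReal]
    refine integral_congr_ae (ae_of_all _ fun x => ?_)
    simp [Complex.mul_conj, Complex.normSq_eq_norm_sq]
  rw [h2] at h1
  exact Complex.ofReal_injective ((Complex.ofReal_pow _ _).trans h1)

/-- Hardy's inequality. -/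
theorem isGradBounded_inv_norm {L : Config N →L[ℝ] EuclideanSpace ℝ (Fin 3)} {i : Fin N}
    (hL : ∀ v, L (Pi.single i v) = v) : IsGradBounded N a fun x => ‖L x‖⁻¹ := by
  refine ⟨L.continuous.norm.measurable.inv, 2, by norm_num, fun φ hφ => ?_⟩
  set ε : ℕ → ℝ := fun n => 1 / ((n : ℝ) + 1) with ε_def
  have hε : ∀ n, 0 < ε n := fun n => Nat.one_div_pos_of_nat
  have hpos : ∀ n x, 0 < ‖L x‖ ^ 2 + ε n := fun n x => add_pos_of_nonneg_of_pos (sq_nonneg _) (hε n)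
  -- The weight `|L|/(|L|² + ε)` has square at most `(|L|² + ε)⁻¹`, the weight in the regularized
  -- inequality. It tends to `|L|⁻¹` everywhere, also where `L x = 0` since `0⁻¹ = 0`, so Fatou's
  -- lemma applies.
  set f : ℕ → Config N → ℂ := fun n x =>
    ((‖L x‖ * (‖L x‖ ^ 2 + ε n)⁻¹ : ℝ) : ℂ) * φ x with f_def
  have hwc : ∀ n, Continuous fun x => (‖L x‖ ^ 2 + ε n)⁻¹ := fun n =>
    Continuous.inv₀ (by fun_prop) fun x => (hpos n x).ne'
  have hfm : ∀ n, AEStronglyMeasurable (f n) (layerMeasure N a) := fun n =>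
    ((Complex.continuous_ofReal.comp (L.continuous.norm.mul (hwc n))).mul
      hφ.1.continuous).aestronglyMeasurable
  have hlim : ∀ x, Filter.Tendsto (fun n => f n x) Filter.atTop (𝓝 (((‖L x‖⁻¹ : ℝ) : ℂ) * φ x)) := by
    intro x
    refine Filter.Tendsto.mul_const _ ((Complex.continuous_ofReal.tendsto _).comp ?_)
    by_cases hx : ‖L x‖ = 0
    · simp [hx]
    · have h1 : Filter.Tendsto (fun n => ‖L x‖ ^ 2 + ε n) Filter.atTop (𝓝 (‖L x‖ ^ 2)) := by
        have := (tendsto_one_div_add_atTop_nhds_zero_nat (𝕜 := ℝ)).const_add (‖L x‖ ^ 2)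
        rwa [add_zero] at this
      have h2 := (h1.inv₀ (pow_ne_zero 2 hx)).const_mul ‖L x‖
      have h3 : ‖L x‖ * (‖L x‖ ^ 2)⁻¹ = ‖L x‖⁻¹ := by field_simp
      rwa [h3] at h2
  have hbound : ∀ n, eLpNorm (f n) 2 (layerMeasure N a)
      ≤ ENNReal.ofReal (2 * gradNorm hφ.toGraph.2) := by
    intro n
    refine (eLpNorm_mono_measure (f n) Measure.restrict_le_self).trans ?_
    refine eLpNorm_two_le (hφ.integrable_mul_norm_sq (hwc n)) (fun x => ?_)
      (mul_nonneg (by norm_num) (gradNorm_nonneg _)) ((hφ.hardy_regularized hL (hε n)).trans ?_)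
    · rw [f_def]
      simp only
      rw [norm_mul, mul_pow, Complex.norm_real, Real.norm_eq_abs, sq_abs, mul_pow]
      refine mul_le_mul_of_nonneg_right ?_ (sq_nonneg _)
      have h1 := (inv_pos.2 (hpos n x)).le
      have h2 : ‖L x‖ ^ 2 * (‖L x‖ ^ 2 + ε n)⁻¹ ≤ 1 := by
        rw [← div_eq_mul_inv, div_le_one (hpos n x)]
        linarith [hε n]
      nlinarith
    · rw [mul_pow, gradNorm, Real.sq_sqrt (by positivity)]
      have h1 : ∑ k, ∫ x, ‖pd i k φ x‖ ^ 2 = ∑ k, ‖hφ.toGraph.2 i k‖ ^ 2 :=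
        Finset.sum_congr rfl fun k _ => (hφ.pd i k).norm_sq_toL2.symm
      have h2 := Finset.single_le_sum (f := fun j => ∑ k, ‖hφ.toGraph.2 j k‖ ^ 2)
        (fun j _ => by positivity) (Finset.mem_univ i)
      rw [h1]
      linarith
  refine (Lp.eLpNorm_lim_le_liminf_eLpNorm hfm _ (ae_of_all _ hlim)).trans ?_
  refine (Filter.liminf_le_liminf (Filter.Eventually.of_forall hbound)).trans ?_
  simp

/-- Approximating test functions converge almost everywhere along a subsequence, and Fatou's lemma
carries the bound to the limit. -/
theorem IsGradBounded.memLp_of_mem_closure {g : Config N → ℝ} (hg : IsGradBounded N a g) :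
    ∃ C, 0 ≤ C ∧ ∀ (u : L2 N a) (v : Fin N → Fin 3 → L2 N a),
      (u, v) ∈ (testGraph N a).topologicalClosure →
        MemLp (fun x => (g x : ℂ) * u x) 2 (layerMeasure N a) ∧
        eLpNorm (fun x => (g x : ℂ) * u x) 2 (layerMeasure N a)
          ≤ ENNReal.ofReal (C * gradNorm v) := by
  obtain ⟨hm, C, hC, h⟩ := hg
  refine ⟨C, hC, fun u v huv => ?_⟩
  have hgm : AEStronglyMeasurable (fun x => (g x : ℂ)) (layerMeasure N a) :=
    (Complex.measurable_ofReal.comp hm).aestronglyMeasurable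
  obtain ⟨q, hq, hlim⟩ := mem_closure_iff_seq_limit.1
    (show (u, v) ∈ closure (testGraph N a : Set (L2 N a × (Fin N → Fin 3 → L2 N a))) from huv)
  have hlim1 : Filter.Tendsto (fun n => (q n).1) Filter.atTop (𝓝 u) :=
    (continuous_fst.tendsto _).comp hlim
  have hlim2 : Filter.Tendsto (fun n => ENNReal.ofReal (C * gradNorm (q n).2)) Filter.atTop
      (𝓝 (ENNReal.ofReal (C * gradNorm v))) :=
    ENNReal.tendsto_ofReal ((((continuous_gradNorm.comp continuous_snd).tendsto _).comp
      hlim).const_mul C)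
  obtain ⟨ns, hns, hae⟩ := (tendstoInMeasure_of_tendsto_Lp hlim1).exists_seq_tendsto_ae
  have hbound : ∀ n, eLpNorm (fun x => (g x : ℂ) * (q n).1 x) 2 (layerMeasure N a)
      ≤ ENNReal.ofReal (C * gradNorm (q n).2) := by
    intro n
    obtain ⟨φ, hφ, e⟩ := mem_testGraph_iff.1 (hq n)
    rw [e]
    refine le_of_eq_of_le (eLpNorm_congr_ae ?_) (h φ hφ)
    filter_upwards [hφ.coeFn_toL2 (a := a)] with x hx
    change (g x : ℂ) * hφ.toL2 a x = _
    rw [hx]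
  have hfin : eLpNorm (fun x => (g x : ℂ) * u x) 2 (layerMeasure N a)
      ≤ ENNReal.ofReal (C * gradNorm v) := by
    refine (Lp.eLpNorm_lim_le_liminf_eLpNorm (f := fun n x => (g x : ℂ) * (q (ns n)).1 x)
      (fun n => hgm.mul (Lp.aestronglyMeasurable _)) _ ?_).trans ?_
    · filter_upwards [hae] with x hx
      exact hx.const_mul _
    · refine (Filter.liminf_le_liminf
        (Filter.Eventually.of_forall fun n => hbound (ns n))).trans ?_
      exact (hlim2.comp hns.tendsto_atTop).liminf_eq.le
  exact ⟨⟨hgm.mul (Lp.aestronglyMeasurable _), hfin.trans_lt ENNReal.ofReal_lt_top⟩, hfin⟩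

theorem isGradBounded_inv_norm_apply (i : Fin N) :
    IsGradBounded N a fun x : Config N => ‖x i‖⁻¹ :=
  isGradBounded_inv_norm
    (L := (ContinuousLinearMap.proj i : Config N →L[ℝ] EuclideanSpace ℝ (Fin 3))) (i := i)
    fun v => by
      rw [ContinuousLinearMap.proj_apply, Pi.single_eq_same]

theorem isGradBounded_inv_norm_sub {i j : Fin N} (hij : j ≠ i) :
    IsGradBounded N a fun x : Config N => ‖x i - x j‖⁻¹ :=
  isGradBounded_inv_norm
    (L := (ContinuousLinearMap.proj i : Config N →L[ℝ] EuclideanSpace ℝ (Fin 3))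
      - (ContinuousLinearMap.proj j : Config N →L[ℝ] EuclideanSpace ℝ (Fin 3))) (i := i)
    fun v => by
      rw [sub_apply, ContinuousLinearMap.proj_apply, ContinuousLinearMap.proj_apply,
        Pi.single_eq_same, Pi.single_eq_of_ne hij, sub_zero]

theorem isGradBounded_potential (N : ℕ) (Z a : ℝ) : IsGradBounded N a (potential N Z) := by
  have e : potential N Z = fun x : Config N => (-1) * ∑ i, Z * ‖x i‖⁻¹
      + ∑ i, ∑ j with i < j, ‖x i - x j‖⁻¹ := by
    ext x
    simp only [potential, div_eq_mul_inv, one_mul, neg_mul]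
  have h1 : IsGradBounded N a fun x : Config N => ∑ i, Z * ‖x i‖⁻¹ :=
    IsGradBounded.sum fun i _ => (isGradBounded_inv_norm_apply i).const_mul Z
  have h2 : IsGradBounded N a fun x : Config N => ∑ i, ∑ j with i < j, ‖x i - x j‖⁻¹ := by
    refine IsGradBounded.sum fun i _ => IsGradBounded.sum fun j hj => ?_
    exact isGradBounded_inv_norm_sub (Finset.mem_filter.1 hj).2.ne'
  rw [e]
  exact (h1.const_mul (-1)).add h2

/-- The Coulomb potential is relatively bounded with respect to the gradient. -/
theorem exists_coulomb_bound (N : ℕ) (Z a : ℝ) :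
    ∃ C, 0 ≤ C ∧ ∀ (u : L2 N a) (v : Fin N → Fin 3 → L2 N a),
      (u, v) ∈ (testGraph N a).topologicalClosure →
        ∃ h : u ∈ (coulomb N Z a).domain, ‖coulomb N Z a ⟨u, h⟩‖ ≤ C * gradNorm v := by
  obtain ⟨C, hC, h⟩ := (isGradBounded_potential N Z a).memLp_of_mem_closure
  refine ⟨C, hC, fun u v huv => ⟨(h u v huv).1, ?_⟩⟩
  have h1 := (h u v huv).2
  change ‖MemLp.toLp _ (h u v huv).1‖ ≤ _
  rw [Lp.norm_toLp]
  exact ENNReal.toReal_le_of_le_ofReal (mul_nonneg hC (gradNorm_nonneg _)) h1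

end GradBounded

/-! ### The scaled Hamiltonians as an analytic family -/

section Hamiltonian

theorem mulOp_symmetric {X : Type*} [MeasurableSpace X] {μ : Measure X} {V : X → ℝ}
    (u u' : (mulOp μ V).domain) :
    inner ℂ (mulOp μ V u) (u' : Lp ℂ 2 μ) = inner ℂ (u : Lp ℂ 2 μ) (mulOp μ V u') := by
  rw [L2.inner_def, L2.inner_def]
  refine integral_congr_ae ?_
  have h1 : mulOp μ V u =ᵐ[μ] fun x => (V x : ℂ) * (u : Lp ℂ 2 μ) x := MemLp.coeFn_toLp u.2
  have h2 : mulOp μ V u' =ᵐ[μ] fun x => (V x : ℂ) * (u' : Lp ℂ 2 μ) x := MemLp.coeFn_toLp u'.2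
  filter_upwards [h1, h2] with x hx1 hx2
  rw [hx1, hx2]
  simp
  ring

variable {N : ℕ} {Z a : ℝ}

theorem mem_hamiltonian_graph_iff {u w : L2 N a} :
    (u, w) ∈ (hamiltonian N Z a).graph ↔ ∃ f, ∃ h : u ∈ (coulomb N Z a).domain,
      (u, f) ∈ dirichletGraph N a ∧ w = f + coulomb N Z a ⟨u, h⟩ := by
  rw [← dirichletLaplacian_graph, LinearPMap.mem_graph_iff]
  constructor
  · rintro ⟨⟨u', h1, h2⟩, rfl, rfl⟩
    exact ⟨_, h2, LinearPMap.mem_graph _ ⟨u', h1⟩, rfl⟩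
  · rintro ⟨f, h2, h, rfl⟩
    obtain ⟨⟨u', h1⟩, rfl, rfl⟩ := (LinearPMap.mem_graph_iff _).1 h
    exact ⟨⟨u', h1, h2⟩, rfl, rfl⟩

theorem mem_scaledHamiltonian_graph_iff {b : ℂ} {u w : L2 N 1} :
    (u, w) ∈ (scaledHamiltonian N Z b).graph ↔ ∃ f, ∃ h : u ∈ (coulomb N Z 1).domain,
      (u, f) ∈ dirichletGraph N 1 ∧ w = (b ^ 2)⁻¹ • (f + b • coulomb N Z 1 ⟨u, h⟩) := by
  rw [← dirichletLaplacian_graph, LinearPMap.mem_graph_iff]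
  constructor
  · rintro ⟨⟨u', h1, h2⟩, rfl, rfl⟩
    exact ⟨_, h2, LinearPMap.mem_graph _ ⟨u', h1⟩, rfl⟩
  · rintro ⟨f, h2, h, rfl⟩
    obtain ⟨⟨u', h1⟩, rfl, rfl⟩ := (LinearPMap.mem_graph_iff _).1 h
    exact ⟨⟨u', h1, h2⟩, rfl, rfl⟩

theorem mem_coulomb_domain {u : L2 N a} (hu : u ∈ H10 N a) : u ∈ (coulomb N Z a).domain := by
  obtain ⟨v, hv⟩ := mem_H10_iff.1 hu
  obtain ⟨C, -, h⟩ := exists_coulomb_bound N Z a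
  exact (h u v hv).1

theorem mem_H10_of_mem_domain {u : L2 N a} (hu : u ∈ (dirichletLaplacian N a).domain) :
    u ∈ H10 N a := by
  have h := LinearPMap.mem_graph (dirichletLaplacian N a) ⟨u, hu⟩
  rw [dirichletLaplacian_graph] at h
  exact h.1

theorem dirichletLaplacian_domain_le :
    (dirichletLaplacian N a).domain ≤ (coulomb N Z a).domain :=
  fun _ hu => mem_coulomb_domain (mem_H10_of_mem_domain hu)

theorem hamiltonian_domain : (hamiltonian N Z a).domain = (dirichletLaplacian N a).domain :=
  inf_eq_left.2 dirichletLaplacian_domain_le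

theorem scaledHamiltonian_domain (b : ℂ) :
    (scaledHamiltonian N Z b).domain = (dirichletLaplacian N 1).domain :=
  inf_eq_left.2 dirichletLaplacian_domain_le

theorem scaledHamiltonian_symmetric (b : ℝ) : IsGraphSymmetric (scaledHamiltonian N Z (b : ℂ)) := by
  intro u w u' w' h h'
  obtain ⟨f, hu, hf, rfl⟩ := mem_scaledHamiltonian_graph_iff.1 h
  obtain ⟨f', hu', hf', rfl⟩ := mem_scaledHamiltonian_graph_iff.1 h'
  have e : inner ℂ (coulomb N Z 1 ⟨u, hu⟩) u' = inner ℂ u (coulomb N Z 1 ⟨u', hu'⟩) :=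
    mulOp_symmetric ⟨u, hu⟩ ⟨u', hu'⟩
  simp only [inner_smul_left, inner_add_left, inner_smul_right, inner_add_right, e,
    dirichletGraph_symmetric hf hf', map_inv₀, map_pow, Complex.conj_ofReal]

/-- `R = (-Δ + s)⁻¹` and `B = 𝒱 R`. -/
structure IsResolventPair (N : ℕ) (Z s : ℝ) (R B : L2 N 1 →L[ℂ] L2 N 1) : Prop where
  graph : ∀ f, (R f, f - (s : ℂ) • R f) ∈ dirichletGraph N 1
  left_inv : ∀ u g, (u, g) ∈ dirichletGraph N 1 → R (g + (s : ℂ) • u) = u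
  coulomb : ∀ f, ∃ h : R f ∈ (coulomb N Z 1).domain, AtomLayer.coulomb N Z 1 ⟨R f, h⟩ = B f

/-- Hardy's bound combined with the gradient estimate for the resolvent. That `C` does not depend on
`s` is what makes `B` small for large `s`. -/
theorem exists_resolventPair (N : ℕ) (Z : ℝ) :
    ∃ C, 0 ≤ C ∧ ∀ s, 0 < s → ∃ R B, IsResolventPair N Z s R B ∧ ‖B‖ ≤ C * Real.sqrt s⁻¹ := by
  obtain ⟨C, hC, hcoul⟩ := exists_coulomb_bound N Z 1
  refine ⟨C, hC, fun s hs => ?_⟩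
  obtain ⟨R, hR⟩ := exists_weak_solution (N := N) (a := 1) hs
  have hdom : ∀ f, R f ∈ (coulomb N Z 1).domain := fun f =>
    mem_coulomb_domain (mem_dirichletGraph_iff.1 (hR f)).1
  let B₀ : L2 N 1 →ₗ[ℂ] L2 N 1 := (coulomb N Z 1).toFun ∘ₗ
    (R : L2 N 1 →ₗ[ℂ] L2 N 1).codRestrict (coulomb N Z 1).domain hdom
  have hB₀ : ∀ f, ‖B₀ f‖ ≤ C * Real.sqrt s⁻¹ * ‖f‖ := by
    intro f
    obtain ⟨v, hv⟩ := mem_H10_iff.1 (mem_dirichletGraph_iff.1 (hR f)).1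
    obtain ⟨h, hle⟩ := hcoul _ v hv
    have h1 : gradNorm v ≤ Real.sqrt s⁻¹ * ‖f‖ := by
      rw [gradNorm, ← Real.sqrt_sq (norm_nonneg f), ← Real.sqrt_mul (inv_pos.2 hs).le]
      exact Real.sqrt_le_sqrt (sum_norm_sq_le hs (hR f) hv)
    rw [mul_assoc]
    exact hle.trans (mul_le_mul_of_nonneg_left h1 hC)
  refine ⟨R, B₀.mkContinuous _ hB₀, ⟨hR, fun u g hug => ?_, fun f => ⟨hdom f, rfl⟩⟩,
    B₀.mkContinuous_norm_le (by positivity) hB₀⟩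
  have h1 := (dirichletGraph N 1).sub_mem (hR (g + (s : ℂ) • u)) hug
  have h2 : R (g + (s : ℂ) • u) - u = 0 := by
    have h3 := norm_le_of_mem_dirichletGraph (u := R (g + (s : ℂ) • u) - u) (f := 0) hs (by
      convert h1 using 1
      refine Prod.ext rfl ?_
      simp only [Prod.snd_sub]
      module)
    rw [norm_zero, mul_zero] at h3
    exact norm_le_zero_iff.1 h3
  exact sub_eq_zero.1 h2

variable {s : ℝ} {R B : L2 N 1 →L[ℂ] L2 N 1}

theorem IsResolventPair.injective (h : IsResolventPair N Z s R B) : Function.Injective R := by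
  rw [injective_iff_map_eq_zero]
  intro f hf
  have := dirichletGraph_functional N 1 _ (h.graph f) hf
  simpa [hf] using this

/-- On the range of `R`, `-ΔR = 1 - sR` and `𝒱R = B`. -/
theorem IsResolventPair.isParametrizedBy (h : IsResolventPair N Z s R B) (b : ℂ) :
    IsParametrizedBy (scaledHamiltonian N Z b) R
      ((b ^ 2)⁻¹ • (1 - (s : ℂ) • R + b • B)) := by
  refine ⟨h.injective, fun u w => ?_⟩
  rw [mem_scaledHamiltonian_graph_iff]
  constructor
  · rintro ⟨f, hu, hf, rfl⟩
    refine ⟨f + (s : ℂ) • u, h.left_inv u f hf, ?_⟩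
    obtain ⟨h1, h2⟩ := h.coulomb (f + (s : ℂ) • u)
    simp only [smul_apply, add_apply, sub_apply, one_apply_eq_self, ← h2, h.left_inv u f hf,
      add_sub_cancel_right]
  · rintro ⟨y, rfl, rfl⟩
    obtain ⟨h1, h2⟩ := h.coulomb y
    exact ⟨_, h1, h.graph y, by simp only [smul_apply, add_apply, sub_apply, one_apply_eq_self, h2]⟩

theorem analyticOnNhd_scaled (R B : L2 N 1 →L[ℂ] L2 N 1) (s : ℝ) :
    AnalyticOnNhd ℂ (fun b : ℂ => (b ^ 2)⁻¹ • (1 - (s : ℂ) • R + b • B)) {0}ᶜ := by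
  intro b hb
  have h1 : AnalyticAt ℂ (fun b : ℂ => (b ^ 2)⁻¹) b :=
    (analyticAt_id.pow 2).inv (pow_ne_zero 2 hb)
  exact h1.smul (analyticAt_const.add (analyticAt_id.smul analyticAt_const))

/-- At `z = -s/b²` the terms in `R` cancel and `M - zR = b⁻²(1 + bB)`, invertible by a Neumann
series. For real `b` this point is real, as the self-adjoint argument requires. -/
theorem exists_mem_opResolventSet (N : ℕ) (Z : ℝ) {b : ℂ} (hb : b ≠ 0) :
    ∃ s : ℝ, -((b ^ 2)⁻¹ * s) ∈ opResolventSet (scaledHamiltonian N Z b) := by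
  obtain ⟨C, hC, h⟩ := exists_resolventPair N Z
  -- With `s = t²`, `‖bB‖ ≤ ‖b‖C/t < 1`.
  set t := ‖b‖ * C + 1 with t_def
  have ht : 0 < t := by positivity
  obtain ⟨R, B, hRB, hB⟩ := h (t ^ 2) (by positivity)
  refine ⟨t ^ 2, _, (hRB.isParametrizedBy b).isResolventAt ?_⟩
  have e : (b ^ 2)⁻¹ • (1 - ((t ^ 2 : ℝ) : ℂ) • R + b • B) - -((b ^ 2)⁻¹ * ((t ^ 2 : ℝ) : ℂ)) • R
      = (b ^ 2)⁻¹ • (1 - (-b) • B) := by module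
  rw [e]
  have hlt : ‖(-b) • B‖ < 1 := by
    rw [norm_smul, norm_neg]
    rw [Real.sqrt_inv, Real.sqrt_sq ht.le] at hB
    calc ‖b‖ * ‖B‖ ≤ ‖b‖ * (C * t⁻¹) := mul_le_mul_of_nonneg_left hB (norm_nonneg _)
      _ = (‖b‖ * C) / t := by ring
      _ < 1 := by rw [div_lt_one ht]; linarith
  exact (isUnit_smul_iff (Units.mk0 _ (inv_ne_zero (pow_ne_zero 2 hb))) _).2
    (isUnit_one_sub_of_norm_lt_one hlt)

/-- The range of `R` lies in the domain. As `R` is symmetric, a vector orthogonal to that range is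
killed by `R`, which is injective. -/
theorem dense_dirichletLaplacian_domain (N : ℕ) :
    Dense ((dirichletLaplacian N 1).domain : Set (L2 N 1)) := by
  obtain ⟨C, -, h⟩ := exists_resolventPair N 0
  obtain ⟨R, B, hRB, -⟩ := h 1 one_pos
  rw [Submodule.dense_iff_topologicalClosure_eq_top, Submodule.topologicalClosure_eq_top_iff,
    Submodule.eq_bot_iff]
  intro x hx
  have hdom : ∀ f, R f ∈ (dirichletLaplacian N 1).domain := fun f => by
    have := hRB.graph f
    rw [← dirichletLaplacian_graph] at this
    exact LinearPMap.mem_domain_of_mem_graph this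
  have hsymm : ∀ f g, inner ℂ (R f) g = inner ℂ f (R g) := fun f g => by
    have := dirichletGraph_symmetric (hRB.graph f) (hRB.graph g)
    simp only [inner_sub_left, inner_smul_left, inner_sub_right, inner_smul_right,
      Complex.conj_ofReal] at this
    linear_combination -this
  refine hRB.injective ?_
  rw [map_zero]
  refine ext_inner_left ℂ fun f => ?_
  rw [← hsymm, inner_zero_right]
  exact (Submodule.mem_orthogonal _ _).1 hx _ (hdom f)

theorem isClosedOpWithResolvent_scaledHamiltonian (N : ℕ) (Z : ℝ) {b : ℂ} (hb : b ≠ 0) :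
    IsClosedOpWithResolvent (scaledHamiltonian N Z b) := by
  obtain ⟨s, S, hS⟩ := exists_mem_opResolventSet N Z hb
  refine ⟨?_, isClosed_of_isResolventAt hS, _, S, hS⟩
  rw [scaledHamiltonian_domain]
  exact dense_dirichletLaplacian_domain N

theorem isConnected_compl_zero : IsConnected ({0}ᶜ : Set ℂ) :=
  isConnected_compl_singleton_of_one_lt_rank (by simp) 0

theorem isAnalyticFamilyTypeA_scaledHamiltonian (N : ℕ) (Z : ℝ) :
    IsAnalyticFamilyTypeA ({0}ᶜ : Set ℂ) (dirichletLaplacian N 1).domain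
      (scaledHamiltonian N Z) := by
  refine ⟨isOpen_compl_singleton, isConnected_compl_zero,
    fun b hb => isClosedOpWithResolvent_scaledHamiltonian N Z hb,
    fun b _ => scaledHamiltonian_domain b, fun ψ hψ => ?_⟩
  have hV : ψ ∈ (coulomb N Z 1).domain := dirichletLaplacian_domain_le hψ
  have hD := LinearPMap.mem_graph (dirichletLaplacian N 1) ⟨ψ, hψ⟩
  rw [dirichletLaplacian_graph] at hD
  refine ⟨fun b => (b ^ 2)⁻¹ • (dirichletLaplacian N 1 ⟨ψ, hψ⟩ + b • coulomb N Z 1 ⟨ψ, hV⟩),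
    fun b hb => ?_, fun b _ => mem_scaledHamiltonian_graph_iff.2 ⟨_, hV, hD, rfl⟩⟩
  have h1 : AnalyticAt ℂ (fun b : ℂ => (b ^ 2)⁻¹) b :=
    (analyticAt_id.pow 2).inv (pow_ne_zero 2 hb)
  exact h1.smul (analyticAt_const.add (analyticAt_id.smul analyticAt_const))

theorem isAnalyticFamilyKato_scaledHamiltonian (N : ℕ) (Z : ℝ) :
    IsAnalyticFamilyKato ({0}ᶜ : Set ℂ) (scaledHamiltonian N Z) := by
  refine ⟨isOpen_compl_singleton, isConnected_compl_zero,
    fun b hb => isClosedOpWithResolvent_scaledHamiltonian N Z hb, fun b hb => ?_⟩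
  obtain ⟨s, hs⟩ := exists_mem_opResolventSet N Z hb
  obtain ⟨C, -, h⟩ := exists_resolventPair N Z
  -- The pair with `s = 1` parametrizes the family for every `a`; it need not be the one that
  -- produced the resolvent point.
  obtain ⟨R, B, hRB, -⟩ := h 1 one_pos
  exact ⟨_, hs, IsParametrizedBy.analyticAt_opResolvent isOpen_compl_singleton
    (analyticOnNhd_scaled R B 1) (fun a _ => hRB.isParametrizedBy a) hb hs⟩

end Hamiltonian

/-! ### Scaling -/

section Scaling

variable {N : ℕ} {Z a b s : ℝ}

theorem preimage_smul_layerPow (N : ℕ) (hs : 0 < s) (hab : a = s * b) :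
    (fun x : Config N => s • x) ⁻¹' layerPow N a = layerPow N b := by
  ext x
  simp only [Set.mem_preimage, layerPow, layer, Set.mem_ofPred_eq, Pi.smul_apply, PiLp.smul_apply,
    smul_eq_mul, abs_mul, abs_of_pos hs, hab, mul_div_assoc]
  exact forall_congr' fun i => mul_lt_mul_iff_right₀ hs

theorem map_smul_layerMeasure (N : ℕ) (hs : 0 < s) (hab : a = s * b) :
    Measure.map (fun x : Config N => s • x) (layerMeasure N b)
      = ENNReal.ofReal ((s ^ (3 * N))⁻¹) • layerMeasure N a := by
  have hfin : Module.finrank ℝ (Config N) = 3 * N := by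
    rw [Module.finrank_pi_fintype]
    simp [mul_comm]
  have h1 := Measure.map_addHaar_smul (volume : Measure (Config N)) hs.ne'
  rw [hfin, abs_of_pos (by positivity)] at h1
  rw [layerMeasure, layerMeasure, ← Measure.restrict_smul, ← h1,
    Measure.restrict_map (measurable_const_smul s) (isOpen_layerPow N a).measurableSet]
  congr 2
  exact (preimage_smul_layerPow N hs hab).symm

theorem quasiMeasurePreserving_smul (N : ℕ) (hs : 0 < s) (hab : a = s * b) :
    Measure.QuasiMeasurePreserving (fun x : Config N => s • x) (layerMeasure N b)
      (layerMeasure N a) := by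
  refine ⟨measurable_const_smul s, ?_⟩
  rw [map_smul_layerMeasure N hs hab]
  exact Measure.smul_absolutelyContinuous

/-- The normalization `s ^ (3 N / 2)`. -/
def scaleFactor (N : ℕ) (s : ℝ) : ℝ := s ^ (3 * (N : ℝ) / 2)

theorem scaleFactor_pos (N : ℕ) (hs : 0 < s) : 0 < scaleFactor N s := Real.rpow_pos_of_pos hs _

theorem memLp_scale (hs : 0 < s) (hab : a = s * b) (ψ : L2 N a) :
    MemLp (fun x => (scaleFactor N s : ℂ) * ψ (s • x)) 2 (layerMeasure N b) := by
  have h1 : MemLp ψ 2 (Measure.map (fun x : Config N => s • x) (layerMeasure N b)) := by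
    rw [map_smul_layerMeasure N hs hab]
    exact (Lp.memLp ψ).smul_measure ENNReal.ofReal_ne_top
  exact (h1.comp_of_map (measurable_const_smul s).aemeasurable).const_mul _

theorem eLpNorm_scale (hs : 0 < s) (hab : a = s * b) (ψ : L2 N a) :
    eLpNorm (fun x => (scaleFactor N s : ℂ) * ψ (s • x)) 2 (layerMeasure N b)
      = eLpNorm ψ 2 (layerMeasure N a) := by
  have h1 : AEStronglyMeasurable ψ (Measure.map (fun x : Config N => s • x) (layerMeasure N b)) := by
    rw [map_smul_layerMeasure N hs hab]
    exact (Lp.aestronglyMeasurable ψ).smul_measure _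
  have h2 : eLpNorm (fun x => ψ (s • x)) 2 (layerMeasure N b)
      = ENNReal.ofReal ((s ^ (3 * N))⁻¹) ^ (1 / 2 : ℝ) * eLpNorm ψ 2 (layerMeasure N a) := by
    rw [show (fun x => ψ (s • x)) = ψ ∘ fun x : Config N => s • x from rfl,
      ← eLpNorm_map_measure h1 (measurable_const_smul s).aemeasurable,
      map_smul_layerMeasure N hs hab, eLpNorm_smul_measure_of_ne_top (by norm_num), smul_eq_mul]
    norm_num
  have h3 : eLpNorm (fun x => (scaleFactor N s : ℂ) * ψ (s • x)) 2 (layerMeasure N b)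
      = ENNReal.ofReal (scaleFactor N s) * eLpNorm (fun x => ψ (s • x)) 2 (layerMeasure N b) := by
    rw [show (fun x => (scaleFactor N s : ℂ) * ψ (s • x))
      = (scaleFactor N s : ℂ) • fun x => ψ (s • x) from rfl, eLpNorm_const_smul, ← ofReal_norm,
      Complex.norm_real, Real.norm_of_nonneg (scaleFactor_pos N hs).le]
  -- The exponent `3N/2` compensates the square root of the Jacobian in dimension `3N`.
  have h4 : scaleFactor N s * ((s ^ (3 * N))⁻¹) ^ (1 / 2 : ℝ) = 1 := by
    rw [scaleFactor, ← Real.rpow_natCast, ← Real.rpow_neg hs.le, ← Real.rpow_mul hs.le,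
      ← Real.rpow_add hs]
    convert Real.rpow_zero s using 2
    push_cast
    ring
  rw [h3, h2, ← mul_assoc, ENNReal.ofReal_rpow_of_nonneg (by positivity) (by norm_num),
    ← ENNReal.ofReal_mul (scaleFactor_pos N hs).le, h4, ENNReal.ofReal_one, one_mul]

/-- `ψ ↦ s ^ (3 N / 2) ψ(s ·)` as an isometry. -/
def scaleL2 (N : ℕ) (hs : 0 < s) (hab : a = s * b) : L2 N a →ₗᵢ[ℂ] L2 N b where
  toFun ψ := (memLp_scale hs hab ψ).toLp _
  map_add' ψ χ := by
    rw [← MemLp.toLp_add]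
    refine MemLp.toLp_congr _ _ ?_
    filter_upwards [(quasiMeasurePreserving_smul N hs hab).ae (Lp.coeFn_add ψ χ)] with x hx
    simp only [hx, Pi.add_apply, mul_add]
  map_smul' c ψ := by
    rw [RingHom.id_apply, ← MemLp.toLp_const_smul]
    refine MemLp.toLp_congr _ _ ?_
    filter_upwards [(quasiMeasurePreserving_smul N hs hab).ae (Lp.coeFn_smul c ψ)] with x hx
    simp only [hx, Pi.smul_apply, smul_eq_mul]
    ring
  norm_map' ψ := by
    change ‖(memLp_scale hs hab ψ).toLp _‖ = _
    rw [Lp.norm_toLp, eLpNorm_scale hs hab, Lp.norm_def]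

theorem coeFn_scaleL2 (hs : 0 < s) (hab : a = s * b) (ψ : L2 N a) :
    scaleL2 N hs hab ψ =ᵐ[layerMeasure N b] fun x => (scaleFactor N s : ℂ) * ψ (s • x) :=
  MemLp.coeFn_toLp (memLp_scale hs hab ψ)

theorem eq_inv_mul_of_eq_mul (hs : 0 < s) (hab : a = s * b) : b = s⁻¹ * a := by
  rw [hab, inv_mul_cancel_left₀ hs.ne']

theorem scaleL2_scaleL2 (hs : 0 < s) (hab : a = s * b) {t : ℝ} (ht : 0 < t) (hba : b = t * a)
    (hst : s * t = 1) (ψ : L2 N a) :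
    scaleL2 N ht hba (scaleL2 N hs hab ψ) = ψ := by
  refine Lp.ext ?_
  filter_upwards [coeFn_scaleL2 ht hba (scaleL2 N hs hab ψ),
    (quasiMeasurePreserving_smul N ht hba).ae (coeFn_scaleL2 hs hab ψ)] with x h1 h2
  have h3 : scaleFactor N t * scaleFactor N s = 1 := by
    rw [scaleFactor, scaleFactor, ← Real.mul_rpow ht.le hs.le, mul_comm, hst, Real.one_rpow]
  rw [h1, h2, smul_smul, hst, one_smul, ← mul_assoc, ← Complex.ofReal_mul, h3, Complex.ofReal_one,
    one_mul]

/-- `ψ ↦ s ^ (3 N / 2) ψ(s ·)` as a unitary map. -/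
def scaleEquiv (N : ℕ) (hs : 0 < s) (hab : a = s * b) : L2 N a ≃ₗᵢ[ℂ] L2 N b :=
  LinearIsometryEquiv.ofSurjective (scaleL2 N hs hab) fun ψ =>
    ⟨scaleL2 N (inv_pos.2 hs) (eq_inv_mul_of_eq_mul hs hab) ψ,
      scaleL2_scaleL2 (inv_pos.2 hs) _ hs hab (inv_mul_cancel₀ hs.ne') ψ⟩

theorem IsTest.scale {φ : Config N → ℂ} (h : IsTest (layerPow N a) φ) (hs : 0 < s)
    (hab : a = s * b) : IsTest (layerPow N b) fun x => φ (s • x) := by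
  refine ⟨h.1.comp (contDiff_const_smul s), h.2.1.comp_homeomorph (Homeomorph.smulOfNeZero s hs.ne'),
    ?_⟩
  rw [← preimage_smul_layerPow N hs hab]
  exact (tsupport_comp_subset_preimage φ (continuous_const_smul s)).trans
    (Set.preimage_mono h.2.2)

theorem pd_scale (φ : Config N → ℂ) (s : ℝ) (i : Fin N) (k : Fin 3) (x : Config N) :
    pd i k (fun x => φ (s • x)) x = (s : ℂ) * pd i k φ (s • x) := by
  rw [pd, fderiv_comp_smul, smul_apply, Complex.real_smul, pd]

theorem scaleL2_toL2 {φ : Config N → ℂ} (h : IsTest (layerPow N a) φ) (hs : 0 < s)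
    (hab : a = s * b) :
    scaleL2 N hs hab (h.toL2 a) = (scaleFactor N s : ℂ) • (h.scale hs hab).toL2 b := by
  refine Lp.ext ?_
  filter_upwards [coeFn_scaleL2 hs hab (h.toL2 a), Lp.coeFn_smul (scaleFactor N s : ℂ)
    ((h.scale hs hab).toL2 b), (h.scale hs hab).coeFn_toL2 (a := b),
    (quasiMeasurePreserving_smul N hs hab).ae h.coeFn_toL2] with x h1 h2 h3 h4
  rw [h1, h2, Pi.smul_apply, h3, h4, smul_eq_mul]

theorem scaleL2_toL2_pd {φ : Config N → ℂ} (h : IsTest (layerPow N a) φ) (hs : 0 < s)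
    (hab : a = s * b) (i : Fin N) (k : Fin 3) :
    (s : ℂ) • scaleL2 N hs hab ((h.pd i k).toL2 a)
      = (scaleFactor N s : ℂ) • ((h.scale hs hab).pd i k).toL2 b := by
  refine Lp.ext ?_
  filter_upwards [coeFn_scaleL2 hs hab ((h.pd i k).toL2 a),
    Lp.coeFn_smul (s : ℂ) (scaleL2 N hs hab ((h.pd i k).toL2 a)),
    Lp.coeFn_smul (scaleFactor N s : ℂ) (((h.scale hs hab).pd i k).toL2 b),
    ((h.scale hs hab).pd i k).coeFn_toL2 (a := b),
    (quasiMeasurePreserving_smul N hs hab).ae (h.pd i k).coeFn_toL2] with x h1 h2 h3 h4 h5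
  rw [h2, h3, Pi.smul_apply, Pi.smul_apply, h1, h4, h5, pd_scale, smul_eq_mul, smul_eq_mul]
  ring

theorem scaleL2_mem_closure (hs : 0 < s) (hab : a = s * b) {u : L2 N a}
    {v : Fin N → Fin 3 → L2 N a} (h : (u, v) ∈ (testGraph N a).topologicalClosure) :
    (scaleL2 N hs hab u, fun i k => (s : ℂ) • scaleL2 N hs hab (v i k))
      ∈ (testGraph N b).topologicalClosure := by
  refine closure_testGraph_induction (P := fun p =>
    (scaleL2 N hs hab p.1, fun i k => (s : ℂ) • scaleL2 N hs hab (p.2 i k))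
      ∈ (testGraph N b).topologicalClosure) ?_ ?_ h
  · refine (testGraph N b).isClosed_topologicalClosure.preimage ?_
    have hc := (scaleL2 N hs hab).continuous
    refine Continuous.prodMk (hc.comp continuous_fst) (continuous_pi fun i => continuous_pi fun k => ?_)
    have h1 : Continuous fun p : L2 N a × (Fin N → Fin 3 → L2 N a) => p.2 i k := by fun_prop
    exact (hc.comp h1).const_smul (s : ℂ)
  · intro φ hφ
    have h1 := (testGraph N b).topologicalClosure.smul_mem (scaleFactor N s : ℂ)
      (hφ.scale hs hab).toGraph_mem
    convert h1 using 1
    refine Prod.ext (scaleL2_toL2 hφ hs hab) ?_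
    funext i k
    exact scaleL2_toL2_pd hφ hs hab i k

/-- The weak equation for the dilated function, tested with `χ`, is the original one tested with
`χ(s⁻¹ ·)`. Each gradient contributes one factor `s`. -/
theorem scaleL2_mem_dirichletGraph (hs : 0 < s) (hab : a = s * b) {u f : L2 N a}
    (h : (u, f) ∈ dirichletGraph N a) :
    (scaleL2 N hs hab u, ((s : ℂ) ^ 2) • scaleL2 N hs hab f) ∈ dirichletGraph N b := by
  obtain ⟨v, hv⟩ := mem_H10_iff.1 (mem_dirichletGraph_iff.1 h).1
  refine mem_dirichletGraph_of_weak (scaleL2_mem_closure hs hab hv) fun χ hχ => ?_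
  have hba := eq_inv_mul_of_eq_mul hs hab
  have hφ := hχ.scale (inv_pos.2 hs) hba
  have hc : (scaleFactor N s : ℂ) ≠ 0 := Complex.ofReal_ne_zero.2 (scaleFactor_pos N hs).ne'
  have hback : (fun x => χ (s⁻¹ • s • x)) = χ := by
    ext x
    rw [inv_smul_smul₀ hs.ne']
  have e1 : hχ.toL2 b = (scaleFactor N s : ℂ)⁻¹ • scaleL2 N hs hab (hφ.toL2 a) := by
    rw [eq_inv_smul_iff₀ hc, scaleL2_toL2 hφ hs hab]
    congr 1
    exact MemLp.toLp_congr _ _ (by rw [hback])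
  have e2 : ∀ i k, (hχ.pd i k).toL2 b
      = (scaleFactor N s : ℂ)⁻¹ • (s : ℂ) • scaleL2 N hs hab ((hφ.pd i k).toL2 a) := fun i k => by
    rw [eq_inv_smul_iff₀ hc, scaleL2_toL2_pd hφ hs hab i k]
    congr 1
    exact MemLp.toLp_congr _ _ (by rw [hback])
  have h1 := inner_eq_of_mem_dirichletGraph h hv hφ.toGraph_mem
  simp only [e1, e2, inner_smul_left, inner_smul_right, LinearIsometry.inner_map_map,
    Complex.conj_ofReal, map_inv₀]
  rw [show inner ℂ (hφ.toL2 a) f = _ from h1]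
  simp only [Finset.mul_sum]
  refine Finset.sum_congr rfl fun i _ => Finset.sum_congr rfl fun k _ => ?_
  ring

theorem mem_dirichletGraph_scaleEquiv_iff (hs : 0 < s) (hab : a = s * b) {u f : L2 N a} :
    (scaleEquiv N hs hab u, ((s : ℂ) ^ 2) • scaleEquiv N hs hab f) ∈ dirichletGraph N b
      ↔ (u, f) ∈ dirichletGraph N a := by
  have hs0 : (s : ℂ) ≠ 0 := Complex.ofReal_ne_zero.2 hs.ne'
  refine ⟨fun h => ?_, fun h => scaleL2_mem_dirichletGraph hs hab h⟩
  have h1 := scaleL2_mem_dirichletGraph (inv_pos.2 hs) (eq_inv_mul_of_eq_mul hs hab) h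
  have e : ∀ ψ : L2 N a, scaleL2 N (inv_pos.2 hs) (eq_inv_mul_of_eq_mul hs hab)
      (scaleEquiv N hs hab ψ) = ψ := fun ψ =>
    scaleL2_scaleL2 hs hab (inv_pos.2 hs) _ (mul_inv_cancel₀ hs.ne') ψ
  rw [map_smul, e, e, smul_smul, Complex.ofReal_inv, ← mul_pow, inv_mul_cancel₀ hs0, one_pow,
    one_smul] at h1
  exact h1

theorem potential_smul (hs : 0 < s) (x : Config N) :
    potential N Z (s • x) = s⁻¹ * potential N Z x := by
  simp only [potential, Pi.smul_apply, ← smul_sub, norm_smul, Real.norm_of_nonneg hs.le,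
    div_eq_mul_inv, mul_inv, mul_add, mul_neg, Finset.mul_sum]
  congr 1
  · congr 1
    exact Finset.sum_congr rfl fun i _ => by ring
  · exact Finset.sum_congr rfl fun i _ => Finset.sum_congr rfl fun j _ => by ring

theorem coulomb_scaleEquiv (hs : 0 < s) (hab : a = s * b) {u : L2 N a}
    (h : u ∈ (coulomb N Z a).domain) (h' : scaleEquiv N hs hab u ∈ (coulomb N Z b).domain) :
    coulomb N Z b ⟨scaleEquiv N hs hab u, h'⟩
      = (s : ℂ) • scaleEquiv N hs hab (coulomb N Z a ⟨u, h⟩) := by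
  have h1 : coulomb N Z b ⟨scaleEquiv N hs hab u, h'⟩ =ᵐ[layerMeasure N b]
      fun x => (potential N Z x : ℂ) * (scaleEquiv N hs hab u) x := MemLp.coeFn_toLp h'
  have h2 : coulomb N Z a ⟨u, h⟩ =ᵐ[layerMeasure N a]
      fun x => (potential N Z x : ℂ) * u x := MemLp.coeFn_toLp h
  refine Lp.ext ?_
  filter_upwards [h1, (quasiMeasurePreserving_smul N hs hab).ae h2,
    coeFn_scaleL2 hs hab u, coeFn_scaleL2 hs hab (coulomb N Z a ⟨u, h⟩),
    Lp.coeFn_smul (s : ℂ) (scaleEquiv N hs hab (coulomb N Z a ⟨u, h⟩))] with x e1 e2 e3 e4 e5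
  have e3' : scaleEquiv N hs hab u x = (scaleFactor N s : ℂ) * u (s • x) := e3
  have e4' : scaleEquiv N hs hab (coulomb N Z a ⟨u, h⟩) x
      = (scaleFactor N s : ℂ) * coulomb N Z a ⟨u, h⟩ (s • x) := e4
  have hs0 : (s : ℂ) ≠ 0 := Complex.ofReal_ne_zero.2 hs.ne'
  rw [e1, e5, Pi.smul_apply, e3', e4', e2, potential_smul hs]
  push_cast
  rw [smul_eq_mul]
  field_simp

/-- Conjugation by the dilation multiplies `-Δ` by `a⁻²` and `𝒱` by `a⁻¹`, and `a⁻²(-Δ) + a⁻¹𝒱 =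
a⁻²(-Δ + a𝒱)`. The Coulomb domain is automatic on `H_0^1`. -/
theorem hamiltonian_graph_iff_scaled {a : ℝ} (ha : 0 < a) (ψ f : L2 N a) :
    (ψ, f) ∈ (hamiltonian N Z a).graph ↔
      (scaleEquiv N ha (mul_one a).symm ψ, scaleEquiv N ha (mul_one a).symm f)
        ∈ (scaledHamiltonian N Z (a : ℂ)).graph := by
  set U := scaleEquiv N ha (mul_one a).symm with U_def
  have ha0 : (a : ℂ) ≠ 0 := Complex.ofReal_ne_zero.2 ha.ne'
  have ha2 : (a : ℂ) ^ 2 ≠ 0 := pow_ne_zero 2 ha0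
  rw [mem_hamiltonian_graph_iff, mem_scaledHamiltonian_graph_iff]
  constructor
  · rintro ⟨g, h, hg, rfl⟩
    have hU := (mem_dirichletGraph_scaleEquiv_iff ha (mul_one a).symm).2 hg
    have h' : U ψ ∈ (coulomb N Z 1).domain := mem_coulomb_domain (mem_dirichletGraph_iff.1 hU).1
    refine ⟨_, h', hU, ?_⟩
    rw [coulomb_scaleEquiv ha (mul_one a).symm h h', smul_smul, ← pow_two, ← smul_add,
      inv_smul_smul₀ ha2, map_add]
  · rintro ⟨g', h', hg', e⟩
    obtain ⟨g, rfl⟩ : ∃ g, g' = ((a : ℂ) ^ 2) • U g :=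
      ⟨U.symm (((a : ℂ) ^ 2)⁻¹ • g'), by rw [U.apply_symm_apply, smul_inv_smul₀ ha2]⟩
    have hg := (mem_dirichletGraph_scaleEquiv_iff ha (mul_one a).symm).1 hg'
    have h : ψ ∈ (coulomb N Z a).domain := mem_coulomb_domain (mem_dirichletGraph_iff.1 hg).1
    refine ⟨g, h, hg, U.injective ?_⟩
    rw [e, coulomb_scaleEquiv ha (mul_one a).symm h h', smul_smul, ← pow_two, ← smul_add,
      inv_smul_smul₀ ha2, map_add]

end Scaling

end

end AtomLayer

theorem mainTheorem8 (N : ℕ) (hN : 1 ≤ N) (Z : ℝ) (hZ : 0 < Z) :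
    -- for `a > 0`, `H^a` is defined on the domain of `-Δ` and the unitary scaling takes it to `H̃^a`
    (∀ a : ℝ, 0 < a →
      (AtomLayer.hamiltonian N Z a).domain = (AtomLayer.dirichletLaplacian N a).domain ∧
      ∃ U : AtomLayer.L2 N a ≃ₗᵢ[ℂ] AtomLayer.L2 N 1,
        (∀ ψ : AtomLayer.L2 N a, U ψ =ᵐ[AtomLayer.layerMeasure N 1]
          fun x => ((a ^ (3 * (N : ℝ) / 2) : ℝ) : ℂ) * ψ (a • x)) ∧
        ∀ ψ f : AtomLayer.L2 N a, (ψ, f) ∈ (AtomLayer.hamiltonian N Z a).graph ↔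
          (U ψ, U f) ∈ (AtomLayer.scaledHamiltonian N Z (a : ℂ)).graph) ∧
    -- type (A) on the fixed domain of the Dirichlet Laplacian
    AtomLayer.IsAnalyticFamilyTypeA ({0}ᶜ : Set ℂ) (AtomLayer.dirichletLaplacian N 1).domain
      (AtomLayer.scaledHamiltonian N Z) ∧
    -- analyticity in the sense of Kato
    AtomLayer.IsAnalyticFamilyKato ({0}ᶜ : Set ℂ) (AtomLayer.scaledHamiltonian N Z) ∧
    -- analytic dependence of the non-degenerate isolated eigenvalues of `H^a`
    (∀ a₀ : ℝ, 0 < a₀ → ∀ E₀ : ℂ,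
      AtomLayer.IsSimpleIsolatedEigenvalue (AtomLayer.hamiltonian N Z a₀) E₀ →
      ∃ δ > 0, ∃ ε > 0, ∃ (E : ℂ → ℂ) (Ψ : ℂ → AtomLayer.L2 N 1),
        AnalyticOnNhd ℂ E (Metric.ball (a₀ : ℂ) δ) ∧
        AnalyticOnNhd ℂ Ψ (Metric.ball (a₀ : ℂ) δ) ∧
        E a₀ = E₀ ∧
        (∀ a ∈ Metric.ball (a₀ : ℂ) δ, a ≠ 0 ∧
          AtomLayer.spec (AtomLayer.scaledHamiltonian N Z a) ∩ Metric.ball E₀ ε = {E a} ∧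
          AtomLayer.IsNondegenerateDiscreteEigenvalue
            (AtomLayer.scaledHamiltonian N Z a) (E a) ∧
          Ψ a ≠ 0 ∧
          (Ψ a, E a • Ψ a) ∈ (AtomLayer.scaledHamiltonian N Z a).graph) ∧
        ∀ a : ℝ, |a - a₀| < δ → 0 < a ∧
          AtomLayer.spec (AtomLayer.hamiltonian N Z a) ∩ Metric.ball E₀ ε = {E a} ∧
          AtomLayer.IsSimpleIsolatedEigenvalue (AtomLayer.hamiltonian N Z a) (E a) ∧
          (E a).im = 0 ∧ ‖Ψ a‖ = 1) := by
  refine ⟨fun a ha => ⟨AtomLayer.hamiltonian_domain,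
    AtomLayer.scaleEquiv N ha (mul_one a).symm,
    AtomLayer.coeFn_scaleL2 ha (mul_one a).symm, AtomLayer.hamiltonian_graph_iff_scaled ha⟩,
    AtomLayer.isAnalyticFamilyTypeA_scaledHamiltonian N Z,
    AtomLayer.isAnalyticFamilyKato_scaledHamiltonian N Z, fun a₀ ha₀ E₀ hE₀ => ?_⟩
  have hU : ∀ a : ℝ, ∀ ha : 0 < a, ∀ ψ f : AtomLayer.L2 N a,
      (ψ, f) ∈ (AtomLayer.hamiltonian N Z a).graph ↔
        ((AtomLayer.scaleEquiv N ha (mul_one a).symm).toContinuousLinearEquiv ψ,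
          (AtomLayer.scaleEquiv N ha (mul_one a).symm).toContinuousLinearEquiv f)
          ∈ (AtomLayer.scaledHamiltonian N Z (a : ℂ)).graph := fun a ha =>
    AtomLayer.hamiltonian_graph_iff_scaled ha
  -- Working in the right half-plane rather than off `0` forces real parameters in the disc to be
  -- positive, where `H^a` and `H̃^a` are unitarily equivalent.
  have hO : IsOpen {b : ℂ | 0 < b.re} := isOpen_lt continuous_const Complex.continuous_re
  have hO0 : ∀ b : ℂ, 0 < b.re → b ≠ 0 := by
    rintro b hb rfl
    exact lt_irrefl _ hb
  obtain ⟨C, -, hC⟩ := AtomLayer.exists_resolventPair N Z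
  obtain ⟨R, B, hRB, -⟩ := hC 1 one_pos
  obtain ⟨s, hs⟩ := AtomLayer.exists_mem_opResolventSet N Z (Complex.ofReal_ne_zero.2 ha₀.ne')
  have hs' : ((-((a₀ ^ 2)⁻¹ * s) : ℝ) : ℂ)
      ∈ AtomLayer.opResolventSet (AtomLayer.scaledHamiltonian N Z (a₀ : ℂ)) := by
    push_cast
    exact hs
  obtain ⟨δ, hδ, ε, hε, E, Ψ, hE, hΨ, hE₀', hcomplex, hreal⟩ :=
    AtomLayer.exists_analytic_eigenvalue (T := AtomLayer.scaledHamiltonian N Z) hO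
      ((AtomLayer.analyticOnNhd_scaled R B 1).mono fun b hb => hO0 b hb)
      (fun b _ => hRB.isParametrizedBy b)
      (fun a _ => AtomLayer.scaledHamiltonian_symmetric a) (a₀ := a₀) (by simpa using ha₀) hs'
      ((AtomLayer.isSimpleIsolatedEigenvalue_iff_of_equiv _ (hU a₀ ha₀) E₀).1 hE₀)
  refine ⟨δ, hδ, ε, hε, E, Ψ, hE, hΨ, hE₀', fun a ha => ⟨hO0 a (hcomplex a ha).1, (hcomplex a ha).2⟩,
    fun a ha => ?_⟩
  have hball : (a : ℂ) ∈ Metric.ball (a₀ : ℂ) δ := by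
    rw [Metric.mem_ball, Complex.dist_eq, ← Complex.ofReal_sub, Complex.norm_real,
      Real.norm_eq_abs]
    exact ha
  have hpos : 0 < a := by simpa using (hcomplex a hball).1
  refine ⟨hpos, ?_, ?_, (hreal a hball).2⟩
  · rw [AtomLayer.spec_eq_of_equiv _ (hU a hpos)]
    exact (hcomplex a hball).2.1
  · exact (AtomLayer.isSimpleIsolatedEigenvalue_iff_of_equiv _ (hU a hpos) _).2 (hreal a hball).1
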